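/- Let $V:\mathbb{R}\to\mathbb{R}$ be bounded and continuous with $V\ge 0$ and $0<\int_{\mathbb{R}}|x|V(x)\,dx<\infty$. Let $S=-\frac{d^2}{dx^2}+V$ be the Schrödinger operator in the real Hilbert space $L^2(\mathbb{R})$ with domain $D(S)=H^2(\mathbb{R})$, and let $S^{1/2}$ be its nonnegative self-adjoint square root. Let $\psi_1$ be an increasing and $\psi_2$ a decreasing solution of $-\psi''+V\psi=0$ on $\mathbb{R}$ such that $$\lim_{x\to-\infty}\big(\psi_1(x),\,x\psi_1'(x)\big)=(1,0),\qquad \lim_{x\to+\infty}\big(\psi_2(x),\,x\psi_2'(x)\big)=(1,0),$$ and put $\psi_V=\psi_1+\psi_2$. Then $D(S^{1/2})=H^1(\mathbb{R})$, and there exists a constant $C>0$ such that for every $f\in D(S^{1/2})\cap L^1(\mathbb{R},\psi_V\,dx)$, $$\|f\|_{L^2}^{2+4/3}\le C\,\|\psi_V f\|_{L^1}^{4/3}\,\|S^{1/2}f\|_{L^2}^{2}.$$ (Increasing and decreasing are meant in the non-strict sense.) -/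

import Mathlib

open MeasureTheory Filter Topology
open scoped ContDiff BoundedContinuousFunction

namespace SchrodingerNash

/-- The real Lebesgue space `L²(ℝ)`. -/
abbrev L2 : Type := Lp ℝ 2 (volume : Measure ℝ)

/-- `g` is the weak (distributional) derivative of `f` on `ℝ`. -/
def IsWeakDeriv (f g : L2) : Prop :=
  ∀ φ : ℝ → ℝ, ContDiff ℝ ∞ φ → HasCompactSupport φ →
    ∫ x, deriv φ x * f x = - ∫ x, φ x * g x

theorem integrable_test_mul (f : L2) {φ : ℝ → ℝ} (hφ : Continuous φ)
    (hc : HasCompactSupport φ) : Integrable (fun x => φ x * f x) :=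
  (hφ.memLp_of_hasCompactSupport (p := 2) (μ := volume) hc).integrable_mul (Lp.memLp f)

theorem IsWeakDeriv.unique {f g h : L2} (hg : IsWeakDeriv f g) (hh : IsWeakDeriv f h) :
    g = h := by
  have hloc : ∀ u : L2, LocallyIntegrable (fun x => u x) (volume : Measure ℝ) := fun u =>
    (Lp.memLp u).locallyIntegrable (by norm_num)
  refine Lp.ext (ae_eq_of_integral_contDiff_smul_eq (hloc g) (hloc h) fun φ hφ hc => ?_)
  have h1 := (hg φ hφ hc).symm.trans (hh φ hφ hc)
  simpa [smul_eq_mul] using h1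

theorem IsWeakDeriv.add {f₁ f₂ g₁ g₂ : L2} (h₁ : IsWeakDeriv f₁ g₁) (h₂ : IsWeakDeriv f₂ g₂) :
    IsWeakDeriv (f₁ + f₂) (g₁ + g₂) := by
  intro φ hφ hc
  have hd : Continuous (deriv φ) := hφ.continuous_deriv (by simp)
  have e1 : ∫ x, deriv φ x * (f₁ + f₂ : L2) x
      = ∫ x, (deriv φ x * f₁ x + deriv φ x * f₂ x) :=
    integral_congr_ae ((Lp.coeFn_add f₁ f₂).mono fun x hx => by
      simp only [hx, Pi.add_apply, mul_add])
  have e2 : ∫ x, φ x * (g₁ + g₂ : L2) x = ∫ x, (φ x * g₁ x + φ x * g₂ x) :=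
    integral_congr_ae ((Lp.coeFn_add g₁ g₂).mono fun x hx => by
      simp only [hx, Pi.add_apply, mul_add])
  rw [e1, e2, integral_add (integrable_test_mul f₁ hd hc.deriv) (integrable_test_mul f₂ hd hc.deriv),
    integral_add (integrable_test_mul g₁ hφ.continuous hc)
      (integrable_test_mul g₂ hφ.continuous hc), h₁ φ hφ hc, h₂ φ hφ hc]
  ring

theorem IsWeakDeriv.smul {f g : L2} (c : ℝ) (h : IsWeakDeriv f g) :
    IsWeakDeriv (c • f) (c • g) := by
  intro φ hφ hc
  have e1 : ∫ x, deriv φ x * (c • f : L2) x = ∫ x, c * (deriv φ x * f x) :=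
    integral_congr_ae ((Lp.coeFn_smul c f).mono fun x hx => by
      simp only [hx, Pi.smul_apply, smul_eq_mul]; ring)
  have e2 : ∫ x, φ x * (c • g : L2) x = ∫ x, c * (φ x * g x) :=
    integral_congr_ae ((Lp.coeFn_smul c g).mono fun x hx => by
      simp only [hx, Pi.smul_apply, smul_eq_mul]; ring)
  rw [e1, e2, integral_const_mul, integral_const_mul, h φ hφ hc]
  ring

theorem isWeakDeriv_zero : IsWeakDeriv 0 0 := by
  have e : ∀ u : ℝ → ℝ, ∫ x, u x * (0 : L2) x = 0 := fun u => by
    rw [integral_congr_ae (g := fun _ => (0 : ℝ))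
      ((Lp.coeFn_zero ℝ 2 (volume : Measure ℝ)).mono fun x hx => by simp)]
    simp
  intro φ _ _
  rw [e, e, neg_zero]

/-- The Sobolev space `H¹(ℝ)`: functions of `L²(ℝ)` with a weak derivative in `L²(ℝ)`. -/
def H1 : Submodule ℝ L2 where
  carrier := {f | ∃ g, IsWeakDeriv f g}
  add_mem' := fun ⟨g₁, h₁⟩ ⟨g₂, h₂⟩ => ⟨g₁ + g₂, h₁.add h₂⟩
  zero_mem' := ⟨0, isWeakDeriv_zero⟩
  smul_mem' := fun c _ ⟨g, h⟩ => ⟨c • g, h.smul c⟩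

/-- The weak derivative `f ↦ f'` as a linear map `H¹(ℝ) → L²(ℝ)`. -/
noncomputable def weakDeriv : H1 →ₗ[ℝ] L2 where
  toFun f := f.2.choose
  map_add' f g := (f + g).2.choose_spec.unique (f.2.choose_spec.add g.2.choose_spec)
  map_smul' c f := (c • f).2.choose_spec.unique (f.2.choose_spec.smul c)

theorem isWeakDeriv_weakDeriv (f : H1) : IsWeakDeriv f (weakDeriv f) := f.2.choose_spec

/-- The Sobolev space `H²(ℝ)`, as a subspace of `H¹(ℝ)`: those `f` with `f' ∈ H¹(ℝ)`. -/
noncomputable def H2sub : Submodule ℝ H1 := H1.comap weakDeriv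

/-- The Sobolev space `H²(ℝ)` as a subspace of `L²(ℝ)`. -/
noncomputable def H2 : Submodule ℝ L2 := H2sub.map H1.subtype

theorem H2_le_H1 : H2 ≤ H1 := by
  rintro _ ⟨f, -, rfl⟩
  exact f.2

theorem weakDeriv_mem_H1 (f : H2) : weakDeriv ⟨f, H2_le_H1 f.2⟩ ∈ H1 := by
  obtain ⟨_, g, hg, rfl⟩ := f
  exact hg

/-- The weak second derivative `f ↦ f''` as a linear map `H²(ℝ) → L²(ℝ)`. -/
noncomputable def weakDeriv₂ : H2 →ₗ[ℝ] L2 where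
  toFun f := weakDeriv ⟨weakDeriv ⟨f, H2_le_H1 f.2⟩, weakDeriv_mem_H1 f⟩
  map_add' f g := by
    rw [← map_add]
    congr 1
    exact Subtype.ext (map_add weakDeriv ⟨f, H2_le_H1 f.2⟩ ⟨g, H2_le_H1 g.2⟩)
  map_smul' c f := by
    rw [RingHom.id_apply, ← map_smul]
    congr 1
    exact Subtype.ext (map_smul weakDeriv c ⟨f, H2_le_H1 f.2⟩)

theorem memLp_mul (V : ℝ →ᵇ ℝ) (f : L2) : MemLp (fun x => V x * f x) 2 (volume : Measure ℝ) :=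
  MemLp.of_le_mul (c := ‖V‖) (Lp.memLp f)
    (V.continuous.aestronglyMeasurable.mul (Lp.aestronglyMeasurable f))
    (Eventually.of_forall fun x => by
      rw [norm_mul]
      exact mul_le_mul_of_nonneg_right (V.norm_coe_le_norm x) (norm_nonneg _))

/-- Multiplication by the bounded continuous function `V` on `L²(ℝ)`. -/
noncomputable def mulOp (V : ℝ →ᵇ ℝ) : L2 →ₗ[ℝ] L2 where
  toFun f := (memLp_mul V f).toLp
  map_add' f g := by
    rw [← MemLp.toLp_add]
    refine MemLp.toLp_congr _ _ ((Lp.coeFn_add f g).mono fun x hx => ?_)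
    simp only [hx, Pi.add_apply, mul_add]
  map_smul' c f := by
    rw [RingHom.id_apply, ← MemLp.toLp_const_smul]
    refine MemLp.toLp_congr _ _ ((Lp.coeFn_smul c f).mono fun x hx => ?_)
    simp only [hx, Pi.smul_apply, smul_eq_mul]
    ring

/-- The Schrödinger operator `S = -d²/dx² + V` in `L²(ℝ)`, with domain `H²(ℝ)`. -/
noncomputable def schrodinger (V : ℝ →ᵇ ℝ) : L2 →ₗ.[ℝ] L2 where
  domain := H2
  toFun := -weakDeriv₂ + (mulOp V).comp H2.subtype

/-- `T` is a nonnegative self-adjoint square root of the (unbounded) operator `A`: it is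
self-adjoint, `⟪T x, x⟫ ≥ 0` on its domain, and `T² = A`, where `T²` has its natural domain
`{x ∈ D(T) | T x ∈ D(T)}`. -/
structure IsNonnegSqrt {E : Type*} [NormedAddCommGroup E] [InnerProductSpace ℝ E]
    [CompleteSpace E] (A T : E →ₗ.[ℝ] E) : Prop where
  isSelfAdjoint : IsSelfAdjoint T
  nonneg : ∀ x : T.domain, 0 ≤ inner ℝ (T x) (x : E)
  sq_eq : ∀ x y : E, (x, y) ∈ A.graph ↔ ∃ z : E, (x, z) ∈ T.graph ∧ (z, y) ∈ T.graph

/-- The square root `A^{1/2}` of a nonnegative self-adjoint operator `A`: its nonnegative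
self-adjoint square root, which exists and is unique for such `A` (for other operators `A` the
value is unspecified). -/
noncomputable def nonnegSqrt {E : Type*} [NormedAddCommGroup E] [InnerProductSpace ℝ E]
    [CompleteSpace E] (A : E →ₗ.[ℝ] E) : E →ₗ.[ℝ] E :=
  Classical.epsilon (IsNonnegSqrt A)

/-- The class `𝒱` of potentials: bounded continuous `V ≥ 0` with `0 < ∫ |x| V(x) dx < ∞`. -/
def potentialClass : Set (ℝ →ᵇ ℝ) :=
  {V | (∀ x, 0 ≤ V x) ∧ Integrable (fun x => |x| * V x) ∧ 0 < ∫ x, |x| * V x}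

/-- `ψ` is a (classical) solution of `-ψ'' + V ψ = 0` on `ℝ`. -/
def IsSolution (V : ℝ →ᵇ ℝ) (ψ : ℝ → ℝ) : Prop :=
  Differentiable ℝ ψ ∧ ∀ x, HasDerivAt (deriv ψ) (V x * ψ x) x

/-- The pair `(ψ₁, ψ₂)` of solutions of `-ψ'' + V ψ = 0`: `ψ₁` is increasing with
`(ψ₁, x ψ₁') → (1, 0)` as `x → -∞`, and `ψ₂` is decreasing with `(ψ₂, x ψ₂') → (1, 0)` as
`x → +∞`. -/
structure IsHarmonicPair (V : ℝ →ᵇ ℝ) (ψ₁ ψ₂ : ℝ → ℝ) : Prop where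
  solution₁ : IsSolution V ψ₁
  solution₂ : IsSolution V ψ₂
  monotone₁ : Monotone ψ₁
  antitone₂ : Antitone ψ₂
  tendsto₁ : Tendsto ψ₁ atBot (𝓝 1)
  tendsto₂ : Tendsto ψ₂ atTop (𝓝 1)
  tendsto_deriv₁ : Tendsto (fun x => x * deriv ψ₁ x) atBot (𝓝 0)
  tendsto_deriv₂ : Tendsto (fun x => x * deriv ψ₂ x) atTop (𝓝 0)

end SchrodingerNash

open SchrodingerNash

/-! The exponent 4/3 is that of Nash's inequality in dimension 3. The weight `ψ₁ + ψ₂` grows at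
least like `1 + |x|`, and writing `f = (1 + |x|) u` turns `dx` into the measure `(1 + |x|)² dx`,
whose balls about 0 have volume of order `r³` for large `r`. The potential, however small, excludes
constants from the form `q = ‖f'‖² + ∫ V f²`, which makes the one-dimensional problem behave like a
transient one.

Since `T² = S` for `T = S^{1/2}`, the identity `‖T f‖² = q` holds on `H²`. As `H²` is dense both in
`H¹` and in `D(T)` for the graph norms, the identity extends and the two domains coincide. Existence
of `T` comes from `R = (1 + S)⁻¹` (Lax–Milgram) by setting `T = (1 - R)^{1/2} R^{-1/2}`, the bounded
roots being power series with Catalan coefficients (`exists_isNonnegSqrt`).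

Three estimates give the inequality. The form bounds `f(x)²` by `K q (1 + |x|)`
(`exists_sq_le_mul_form`). This growth bound makes Hardy's inequality available on the line, so `∫
f² / (1 + x²)` is at most a constant times `q` (`LocAC.integral_sq_div_le`). Splitting according to
whether `|f| ≤ l (1 + |x|)` interpolates between the weighted `L¹` norm and the Hardy integral
(`pow_four_mul_sq_le`), and optimizing in `l` yields `‖f‖¹⁰ ≤ C m⁴ q³` with `m = ∫ (1 + |x|) |f|`.
Convexity of the solutions bounds `m` by the norm with weight `ψ₁ + ψ₂`
(`IsHarmonicPair.exists_weight_le`). -/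

namespace SchrodingerNash

/-! ### Square roots of operators on a real Hilbert space -/

/-- The closed form bounds the series by 2 at the boundary of its disc of convergence, so the
operator series below converges even when `‖A‖ = 1`. -/
theorem sum_catalan_div_four_pow (N : ℕ) :
    ∑ n ∈ Finset.range N, (catalan n : ℝ) / 4 ^ n = 2 * (1 - (N.centralBinom : ℝ) / 4 ^ N) := by
  induction N with
  | zero => simp
  | succ n ih =>
    rw [Finset.sum_range_succ, ih]
    have h1 : ((n : ℝ) + 1) * ((n + 1).centralBinom : ℝ) = 2 * (2 * n + 1) * n.centralBinom := by
      exact_mod_cast Nat.succ_mul_centralBinom_succ n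
    have h2 : ((n : ℝ) + 1) * catalan n = n.centralBinom := by
      exact_mod_cast succ_mul_catalan_eq_centralBinom n
    have h3 : ((n + 1).centralBinom : ℝ) = 2 * (2 * n + 1) * catalan n := by
      have : (n : ℝ) + 1 ≠ 0 := by positivity
      apply mul_left_cancel₀ this
      rw [h1, ← h2]; ring
    rw [h3, ← h2, pow_succ]
    field_simp
    ring

theorem sum_catalan_div_four_pow_le (N : ℕ) :
    ∑ n ∈ Finset.range N, (catalan n : ℝ) / 4 ^ n ≤ 2 := by
  rw [sum_catalan_div_four_pow]
  have : 0 ≤ (N.centralBinom : ℝ) / 4 ^ N := by positivity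
  linarith

theorem summable_catalan_div_four_pow : Summable fun n => (catalan n : ℝ) / 4 ^ n :=
  summable_of_sum_range_le (fun n => by positivity) sum_catalan_div_four_pow_le

theorem tsum_catalan_div_four_pow_le : ∑' n, (catalan n : ℝ) / 4 ^ n ≤ 2 :=
  Real.tsum_le_of_sum_range_le (fun n => by positivity) sum_catalan_div_four_pow_le

/-- By Cauchy–Schwarz `⟪(1 - B) x, x⟫ ≤ ‖x‖²`. The bound on `‖1 - B‖` thus serves as a certificate
of positivity for the roots. -/
theorem inner_self_nonneg_of_norm_one_sub_le {E : Type*} [NormedAddCommGroup E]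
    [InnerProductSpace ℝ E] {B : E →L[ℝ] E} (h : ‖1 - B‖ ≤ 1) (x : E) :
    0 ≤ inner ℝ (B x) x := by
  have h1 : inner ℝ ((1 - B) x) x ≤ ‖x‖ * ‖x‖ :=
    (real_inner_le_norm _ _).trans
      (mul_le_mul_of_nonneg_right (by simpa using (1 - B).le_of_opNorm_le h x) (norm_nonneg _))
  simp only [sub_apply, one_apply_eq_self, inner_sub_left,
    real_inner_self_eq_norm_mul_norm] at h1
  linarith

section Sqrt

variable {E : Type*} [NormedAddCommGroup E] [InnerProductSpace ℝ E] [CompleteSpace E]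

/-- The square root of `1 - A`, for a self-adjoint contraction `A` of a real Hilbert space,
from the power series of `√(1 - x)`, whose coefficients are Catalan numbers. -/
theorem exists_sqrt_one_sub {A : E →L[ℝ] E} (hA : IsSelfAdjoint A) (h : ‖A‖ ≤ 1) :
    ∃ B : E →L[ℝ] E, IsSelfAdjoint B ∧ B * B = 1 - A ∧ ‖1 - B‖ ≤ 1 ∧
      ∀ X, Commute X A → Commute X B := by
  set t : ℕ → (E →L[ℝ] E) := fun n => ((catalan n : ℝ) / 4 ^ n) • A ^ n with ht
  have hpow : ∀ n : ℕ, ‖A ^ n‖ ≤ 1 := by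
    intro n
    rcases Nat.eq_zero_or_pos n with rfl | hn
    · simpa using (show ‖(1 : E →L[ℝ] E)‖ ≤ 1 from ContinuousLinearMap.norm_id_le)
    · exact (norm_pow_le' A hn).trans (pow_le_one₀ (norm_nonneg _) h)
  have hle : ∀ n, ‖t n‖ ≤ (catalan n : ℝ) / 4 ^ n := by
    intro n
    rw [ht, norm_smul, Real.norm_of_nonneg (by positivity)]
    exact mul_le_of_le_one_right (by positivity) (hpow n)
  have hsn : Summable fun n => ‖t n‖ :=
    Summable.of_nonneg_of_le (fun _ => norm_nonneg _) hle summable_catalan_div_four_pow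
  have hs : Summable t := hsn.of_norm
  set Y := ∑' n, t n with hY
  have hYn : ‖Y‖ ≤ 2 :=
    (norm_tsum_le_tsum_norm hsn).trans
      ((hsn.tsum_le_tsum hle summable_catalan_div_four_pow).trans tsum_catalan_div_four_pow_le)
  have hcomm : ∀ X, Commute X A → Commute X Y := fun X hX =>
    Commute.tsum_right X fun n => (hX.pow_right n).smul_right _
  have hAY : A * Y = Y * A := hcomm A (Commute.refl A)
  -- The Catalan convolution identity, read through the Cauchy product of the series with itself.
  have hrec : Y = 1 + (1 / 4 : ℝ) • (A * (Y * Y)) := by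
    have h1 : Y = t 0 + ∑' n, t (n + 1) := hs.tsum_eq_zero_add
    have h2 : Y * Y = ∑' n, ∑ kl ∈ Finset.HasAntidiagonal.antidiagonal n, t kl.1 * t kl.2 :=
      tsum_mul_tsum_eq_tsum_sum_antidiagonal_of_summable_norm hsn hsn
    have h3 : Summable fun n => ∑ kl ∈ Finset.HasAntidiagonal.antidiagonal n, t kl.1 * t kl.2 :=
      (summable_norm_sum_mul_antidiagonal_of_summable_norm hsn hsn).of_norm
    have h4 : ∀ n, t (n + 1) =
        (1 / 4 : ℝ) • (A * ∑ kl ∈ Finset.HasAntidiagonal.antidiagonal n, t kl.1 * t kl.2) := by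
      intro n
      have h5 : ∀ kl ∈ Finset.HasAntidiagonal.antidiagonal n, t kl.1 * t kl.2 =
          ((catalan kl.1 * catalan kl.2 : ℝ) / 4 ^ n) • A ^ n := by
        intro kl hkl
        have := Finset.HasAntidiagonal.mem_antidiagonal.1 hkl
        rw [ht]
        simp only [smul_mul_smul_comm, ← pow_add, this]
        congr 1
        rw [div_mul_div_comm, ← pow_add, this]
      rw [Finset.sum_congr rfl h5, ← Finset.sum_smul, mul_smul_comm, smul_smul, ← pow_succ', ht]
      simp only
      congr 1
      rw [catalan_succ', ← Finset.sum_div, pow_succ]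
      push_cast
      field_simp
    rw [h2, ← h3.tsum_mul_left, ← Summable.tsum_const_smul _ (h3.mul_left A)]
    conv_lhs => rw [h1]
    congr 1
    · simp [ht]
    · exact tsum_congr h4
  have hsa : IsSelfAdjoint Y := by
    rw [IsSelfAdjoint, hY, tsum_star]
    refine tsum_congr fun n => ?_
    exact ((IsSelfAdjoint.all _).smul (hA.pow n) : IsSelfAdjoint (t n))
  -- Formally `Y = 2 (1 - √(1 - A)) / A`, so this witness is `√(1 - A)`; `‖Y‖ ≤ 2` gives `‖1 - B‖ ≤
  -- 1`.
  refine ⟨1 - (1 / 2 : ℝ) • (A * Y), ?_, ?_, ?_, ?_⟩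
  · refine (IsSelfAdjoint.one _).sub ((IsSelfAdjoint.all _).smul ?_)
    rw [IsSelfAdjoint, star_mul, hA.star_eq, hsa.star_eq, hAY]
  · have h1 : A * Y = A + (1 / 4 : ℝ) • (A * Y * (A * Y)) := by
      conv_lhs => rw [hrec]
      rw [mul_add, mul_one, mul_smul_comm]
      congr 2
      simp only [mul_assoc]
      rw [← mul_assoc Y A Y, ← hAY, mul_assoc]
    have h2 : (1 - (1 / 2 : ℝ) • (A * Y)) * (1 - (1 / 2 : ℝ) • (A * Y)) =
        1 - A * Y + (1 / 4 : ℝ) • (A * Y * (A * Y)) := by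
      rw [sub_mul, mul_sub, mul_sub, smul_mul_smul_comm, one_mul, one_mul, mul_one]
      module
    rw [h2]
    nth_rewrite 1 [h1]
    abel
  · rw [sub_sub_cancel, norm_smul]
    have := (norm_mul_le A Y).trans (mul_le_mul h hYn (norm_nonneg _) zero_le_one)
    norm_num
    linarith
  · intro X hX
    exact (Commute.one_right X).sub_right ((hX.mul_right (hcomm X hX)).smul_right _)

/-- A nonnegative symmetric operator `A` with `1 + A` surjective has a nonnegative self-adjoint
square root. -/
theorem exists_isNonnegSqrt (A : E →ₗ.[ℝ] E)
    (hsymm : ∀ x y : A.domain, inner ℝ (A x) (y : E) = inner ℝ (x : E) (A y))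
    (hnonneg : ∀ x : A.domain, 0 ≤ inner ℝ (A x) (x : E))
    (hsurj : ∀ f : E, ∃ x : A.domain, (x : E) + A x = f) :
    ∃ T, IsNonnegSqrt A T := by
  -- With the cross term nonnegative, this one expansion gives injectivity of `1 + A` and makes both
  -- `R = (1 + A)⁻¹` and `1 - R` contractions.
  have hexp : ∀ x : A.domain, ‖(x : E) + A x‖ ^ 2 =
      ‖(x : E)‖ ^ 2 + 2 * inner ℝ (A x) (x : E) + ‖A x‖ ^ 2 := by
    intro x
    rw [norm_add_sq_real, real_inner_comm]
  let J : A.domain →ₗ[ℝ] E := A.domain.subtype + A.toFun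
  have hJ : ∀ x, J x = (x : E) + A x := fun _ => rfl
  have hinj : Function.Injective J := by
    refine (injective_iff_map_eq_zero J).2 fun x hx => ?_
    have h1 := hexp x
    rw [← hJ, hx, norm_zero] at h1
    have h2 := hnonneg x
    have h3 : ‖(x : E)‖ = 0 := by nlinarith [norm_nonneg (x : E), sq_nonneg ‖A x‖]
    exact Subtype.ext (norm_eq_zero.1 h3)
  let e := LinearEquiv.ofBijective J ⟨hinj, fun f => hsurj f⟩
  have he : ∀ f, ((e.symm f : A.domain) : E) + A (e.symm f) = f := fun f => e.apply_symm_apply f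
  let R : E →L[ℝ] E := LinearMap.mkContinuous (A.domain.subtype ∘ₗ e.symm.toLinearMap) 1 (by
    intro f
    have h1 := hexp (e.symm f)
    rw [he] at h1
    have h2 := hnonneg (e.symm f)
    rw [one_mul]
    refine le_of_sq_le_sq ?_ (norm_nonneg f)
    change ‖((e.symm f : A.domain) : E)‖ ^ 2 ≤ _
    nlinarith [sq_nonneg ‖A (e.symm f)‖])
  have hR : ∀ f, R f = ((e.symm f : A.domain) : E) := fun _ => rfl
  have hRA : ∀ f, f - R f = A (e.symm f) := fun f => by
    rw [hR]; nth_rewrite 1 [← he f]; abel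
  have hRn : ‖R‖ ≤ 1 := LinearMap.mkContinuous_norm_le _ zero_le_one _
  have hRn' : ‖1 - R‖ ≤ 1 := by
    refine ContinuousLinearMap.opNorm_le_bound _ zero_le_one fun f => ?_
    have h1 := hexp (e.symm f)
    rw [he] at h1
    have h2 := hnonneg (e.symm f)
    rw [one_mul, sub_apply, one_apply_eq_self, hRA]
    refine le_of_sq_le_sq ?_ (norm_nonneg f)
    nlinarith [sq_nonneg ‖((e.symm f : A.domain) : E)‖]
  have hRsa : IsSelfAdjoint R := by
    rw [ContinuousLinearMap.isSelfAdjoint_iff_isSymmetric]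
    intro f g
    have h1 := hsymm (e.symm f) (e.symm g)
    rw [← hRA, ← hRA, ← hR, ← hR, inner_sub_left, inner_sub_right] at h1
    change inner ℝ (R f) g = inner ℝ f (R g)
    linarith
  -- `B = R^{1/2}`, `C = (1 - R)^{1/2}` and `D = B^{1/2}`. The operator `D` is needed only for the
  -- positivity of `T`.
  obtain ⟨B, hBsa, hBB, hBn, hBc⟩ := exists_sqrt_one_sub ((IsSelfAdjoint.one _).sub hRsa) hRn'
  obtain ⟨C, hCsa, hCC, hCn, hCc⟩ := exists_sqrt_one_sub hRsa hRn
  obtain ⟨D, hDsa, hDD, -, hDc⟩ := exists_sqrt_one_sub ((IsSelfAdjoint.one _).sub hBsa) hBn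
  rw [sub_sub_cancel] at hBB hDD
  have hRC : Commute R C := hCc R (Commute.refl R)
  have hCB : Commute C B := hBc C ((Commute.one_right C).sub_right hRC.symm)
  have hCD : Commute C D := hDc C ((Commute.one_right C).sub_right hCB)
  have aB : ∀ x, B (B x) = R x := fun x => by rw [← hBB]; rfl
  have aC : ∀ x, C (C x) = x - R x := fun x => by
    have : (C * C) x = x - R x := by rw [hCC]; rfl
    exact this
  have aD : ∀ x, D (D x) = B x := fun x => by rw [← hDD]; rfl
  have aCB : ∀ x, C (B x) = B (C x) := fun x => congrArg (fun F : E →L[ℝ] E => F x) hCB.eq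
  have aCD : ∀ x, C (D x) = D (C x) := fun x => congrArg (fun F : E →L[ℝ] E => F x) hCD.eq
  have sB : ∀ x y, inner ℝ (B x) y = inner ℝ x (B y) :=
    (ContinuousLinearMap.isSelfAdjoint_iff_isSymmetric.1 hBsa)
  have sC : ∀ x y, inner ℝ (C x) y = inner ℝ x (C y) :=
    (ContinuousLinearMap.isSelfAdjoint_iff_isSymmetric.1 hCsa)
  have sD : ∀ x y, inner ℝ (D x) y = inner ℝ x (D y) :=
    (ContinuousLinearMap.isSelfAdjoint_iff_isSymmetric.1 hDsa)
  have hRinj : ∀ x, R x = 0 → x = 0 := by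
    intro x hx
    have h1 : e.symm x = 0 := Subtype.ext hx
    have h2 := he x
    rw [h1] at h2
    simpa using h2.symm
  have hBinj : ∀ x, B x = 0 → x = 0 := fun x hx => hRinj x (by rw [← aB, hx, map_zero])
  -- The graph of `T = C B⁻¹`, parametrized by `u ↦ (B u, C u)`; injectivity of `B` makes it
  -- single-valued.
  let g : Submodule ℝ (E × E) := LinearMap.range (B.toLinearMap.prod C.toLinearMap)
  have hg : ∀ x y, (x, y) ∈ g ↔ ∃ u, B u = x ∧ C u = y := by
    intro x y
    simp [g, LinearMap.mem_range, Prod.ext_iff]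
  have hgr : g.toLinearPMap.graph = g := by
    refine Submodule.toLinearPMap_graph_eq _ ?_
    rintro ⟨x, y⟩ hxy (h0 : x = 0)
    obtain ⟨u, hu, rfl⟩ := (hg x y).1 hxy
    rw [h0] at hu
    simp [hBinj u hu]
  have hdense : Dense (g.toLinearPMap.domain : Set E) := by
    rw [Submodule.dense_iff_topologicalClosure_eq_top, Submodule.topologicalClosure_eq_top_iff,
      Submodule.eq_bot_iff]
    intro x hx
    have h1 : B (B x) ∈ g.toLinearPMap.domain := by
      rw [LinearPMap.mem_domain_iff]
      exact ⟨C (B x), by rw [hgr, hg]; exact ⟨_, rfl, rfl⟩⟩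
    have h2 : inner ℝ (B (B x)) x = 0 := hx _ h1
    rw [sB] at h2
    exact hBinj x (inner_self_eq_zero.1 h2)
  refine ⟨g.toLinearPMap, ?_, ?_, ?_⟩
  · rw [LinearPMap.isSelfAdjoint_def]
    apply LinearPMap.eq_of_eq_graph
    rw [LinearPMap.adjoint_graph_eq_graph_adjoint hdense, hgr]
    ext ⟨u, v⟩
    rw [Submodule.mem_adjoint_iff, hg]
    constructor
    · intro h
      have h1 : ∀ x, inner ℝ x (C u - B v) = 0 := fun x => by
        rw [inner_sub_right, ← sC, ← sB]
        exact h _ _ ((hg _ _).2 ⟨x, rfl, rfl⟩)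
      have h2 : C u = B v := sub_eq_zero.1 (inner_self_eq_zero.1 (h1 _))
      -- As `B² + C² = 1` and `C u = B v`, this vector `w` satisfies `B w = u` and `C w = v`.
      refine ⟨B u + C v, ?_, ?_⟩
      · rw [map_add, aB, ← aCB, ← h2, aC]; abel
      · rw [map_add, aCB, h2, aB, aC]; abel
    · rintro ⟨w, rfl, rfl⟩ a b hab
      obtain ⟨x, rfl, rfl⟩ := (hg a b).1 hab
      rw [sC, sB, aCB, sub_self]
  · intro x
    have h1 := g.toLinearPMap.mem_graph x
    rw [hgr, hg] at h1
    obtain ⟨u, hu, hu'⟩ := h1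
    -- `⟪C u, B u⟫ = ⟪C (D u), D u⟫`, because `B = D²` and `D` is symmetric and commutes with `C`.
    rw [← hu, ← hu', ← aD, ← sD, ← aCD]
    exact inner_self_nonneg_of_norm_one_sub_le hCn _
  · intro x y
    simp only [hgr, hg]
    have hAg : (x, y) ∈ A.graph ↔ ∃ f, R f = x ∧ f - R f = y := by
      rw [LinearPMap.mem_graph_iff]
      constructor
      · rintro ⟨z, rfl, rfl⟩
        refine ⟨J z, ?_, ?_⟩
        · rw [hR]; exact congrArg Subtype.val (e.symm_apply_apply z)
        · rw [hRA]; exact congrArg A (e.symm_apply_apply z)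
      · rintro ⟨f, rfl, rfl⟩
        exact ⟨e.symm f, rfl, (hRA f).symm⟩
    rw [hAg]
    constructor
    · rintro ⟨f, rfl, rfl⟩
      exact ⟨B (C f), ⟨B f, aB f, aCB f⟩, ⟨C f, rfl, aC f⟩⟩
    · rintro ⟨z, ⟨u, rfl, rfl⟩, v, hv, rfl⟩
      refine ⟨B u + C v, ?_, ?_⟩
      · have h1 : B (B u + C v) = u := by rw [map_add, aB, ← aCB, hv, aC]; abel
        rw [← aB, h1]
      · have h1 : C (B u + C v) = v := by rw [map_add, aCB, ← hv, aB, aC]; abel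
        rw [← aC, h1]

end Sqrt

/-! ### Locally absolutely continuous functions and integration by parts -/

/-- `F` is absolutely continuous on every bounded interval. -/
def LocAC (F : ℝ → ℝ) : Prop := ∀ a b, AbsolutelyContinuousOnInterval F a b

namespace LocAC

variable {F G : ℝ → ℝ}

theorem continuous (hF : LocAC F) : Continuous F := by
  refine continuous_iff_continuousAt.2 fun x => ?_
  refine (hF (x - 1) (x + 1)).continuousOn.continuousAt ?_
  rw [Set.uIcc_of_le (by linarith)]
  exact Icc_mem_nhds (by linarith) (by linarith)

theorem mul (hF : LocAC F) (hG : LocAC G) : LocAC fun x => F x * G x :=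
  fun a b => (hF a b).fun_mul (hG a b)

theorem _root_.ContDiff.locAC (hF : ContDiff ℝ 1 F) : LocAC F :=
  fun _ _ => hF.contDiffOn.absolutelyContinuousOnInterval

theorem ae_differentiableAt (hF : LocAC F) : ∀ᵐ x, DifferentiableAt ℝ F x := by
  have h : ∀ᵐ x, ∀ n : ℕ, x ∈ Set.uIcc (-(n : ℝ)) n → DifferentiableAt ℝ F x :=
    ae_all_iff.2 fun n => (hF _ _).ae_differentiableAt
  filter_upwards [h] with x hx
  obtain ⟨n, hn⟩ := exists_nat_ge |x|
  refine hx n ?_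
  rw [Set.uIcc_of_le (by linarith [abs_nonneg x])]
  exact abs_le.1 hn

theorem deriv_mul_ae (hF : LocAC F) (hG : LocAC G) :
    ∀ᵐ x, deriv (fun y => F y * G y) x = deriv F x * G x + F x * deriv G x := by
  filter_upwards [hF.ae_differentiableAt, hG.ae_differentiableAt] with x h1 h2
  exact (h1.hasDerivAt.mul h2.hasDerivAt).deriv

theorem locallyIntegrable_deriv (hF : LocAC F) : LocallyIntegrable (deriv F) := by
  intro x
  refine ⟨Set.Ioc (x - 1) (x + 1), Ioc_mem_nhds (by linarith) (by linarith), ?_⟩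
  exact (intervalIntegrable_iff_integrableOn_Ioc_of_le (by linarith)).1
    (hF (x - 1) (x + 1)).intervalIntegrable_deriv

/-- The derivative of an integrable locally absolutely continuous function has integral zero. -/
theorem integral_deriv_eq_zero (hF : LocAC F) (hi : Integrable F) (hd : Integrable (deriv F)) :
    ∫ x, deriv F x = 0 := by
  have hF0 : ∀ x, F x = F 0 + ∫ t in (0 : ℝ)..x, deriv F t := fun x => by
    rw [(hF 0 x).integral_deriv_eq_sub]; ring
  have htop : Tendsto F atTop (𝓝 (F 0 + ∫ t in Set.Ioi 0, deriv F t)) := by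
    have := (intervalIntegral_tendsto_integral_Ioi 0 hd.integrableOn tendsto_id).const_add (F 0)
    exact this.congr fun x => (hF0 x).symm
  have hbot : Tendsto F atBot (𝓝 (F 0 - ∫ t in Set.Iic 0, deriv F t)) := by
    have := (intervalIntegral_tendsto_integral_Iic 0 hd.integrableOn tendsto_id).const_sub (F 0)
    refine this.congr fun x => ?_
    rw [hF0 x, intervalIntegral.integral_symm, id]
    ring
  -- An integrable function that has a limit at infinity has limit zero there.
  have h1 : F 0 + ∫ t in Set.Ioi 0, deriv F t = 0 := by
    refine IntegrableAtFilter.eq_zero_of_tendsto (hi.integrableAtFilter atTop) ?_ htop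
    intro s hs
    rw [mem_atTop_sets] at hs
    obtain ⟨b, hb⟩ := hs
    rw [← top_le_iff, ← Real.volume_Ici (a := b)]
    exact measure_mono hb
  have h2 : F 0 - ∫ t in Set.Iic 0, deriv F t = 0 := by
    refine IntegrableAtFilter.eq_zero_of_tendsto (hi.integrableAtFilter atBot) ?_ hbot
    intro s hs
    rw [mem_atBot_sets] at hs
    obtain ⟨b, hb⟩ := hs
    rw [← top_le_iff, ← Real.volume_Iic (a := b)]
    exact measure_mono hb
  rw [← intervalIntegral.integral_Iic_add_Ioi (b := 0) hd.integrableOn hd.integrableOn]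
  linarith

theorem integral_deriv_mul_add_eq_zero (hF : LocAC F) (hG : LocAC G)
    (hi : Integrable fun x => F x * G x) (h1 : Integrable fun x => deriv F x * G x)
    (h2 : Integrable fun x => F x * deriv G x) :
    ∫ x, deriv F x * G x = - ∫ x, F x * deriv G x := by
  have h := (hF.mul hG).integral_deriv_eq_zero hi
    ((h1.add h2).congr ((hF.deriv_mul_ae hG).mono fun x hx => hx.symm))
  rw [integral_congr_ae (hF.deriv_mul_ae hG), integral_add h1 h2] at h
  linarith

theorem integral_deriv_mul_test (hF : LocAC F) {φ : ℝ → ℝ} (hφ : ContDiff ℝ ∞ φ)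
    (hc : HasCompactSupport φ) : ∫ x, deriv φ x * F x = - ∫ x, φ x * deriv F x := by
  have hφ1 : ContDiff ℝ 1 φ := hφ.of_le (by exact_mod_cast le_top)
  refine hφ1.locAC.integral_deriv_mul_add_eq_zero hF ?_ ?_ ?_
  · exact (hφ.continuous.mul hF.continuous).integrable_of_hasCompactSupport hc.mul_right
  · exact ((hφ1.continuous_deriv le_rfl).mul hF.continuous).integrable_of_hasCompactSupport
      hc.deriv.mul_right
  · exact hF.locallyIntegrable_deriv.integrable_smul_left_of_hasCompactSupport hφ.continuous hc

theorem of_integral {g : ℝ → ℝ} (hg : LocallyIntegrable g) (c : ℝ) :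
    LocAC (fun x => c + ∫ t in (0 : ℝ)..x, g t) ∧
      ∀ᵐ x, deriv (fun x => c + ∫ t in (0 : ℝ)..x, g t) x = g x := by
  constructor
  · have hI : ∀ a b, IntervalIntegrable g volume a b := fun a b =>
      (hg.integrableOn_isCompact isCompact_uIcc).intervalIntegrable
    have h0 : ∀ a b, (0 : ℝ) ∈ Set.uIcc a b →
        AbsolutelyContinuousOnInterval (fun x => c + ∫ t in (0 : ℝ)..x, g t) a b := by
      intro a b h
      have h1 : AbsolutelyContinuousOnInterval (fun _ : ℝ => c) a b :=
        (contDiff_const (n := 1)).contDiffOn.absolutelyContinuousOnInterval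
      exact h1.add ((hI a b).absolutelyContinuousOnInterval_intervalIntegral h)
    intro a b
    -- `h0` requires the base point 0 to lie in the interval, so `[a, b]` is enlarged to a symmetric
    -- one.
    refine (h0 (-(|a| + |b|)) (|a| + |b|) ?_).mono ?_
    · rw [Set.uIcc_of_le (by linarith [abs_nonneg a, abs_nonneg b])]
      constructor <;> linarith [abs_nonneg a, abs_nonneg b]
    · refine Set.uIcc_subset_uIcc ?_ ?_ <;>
      · rw [Set.uIcc_of_le (by linarith [abs_nonneg a, abs_nonneg b])]
        constructor <;>
          linarith [abs_nonneg a, abs_nonneg b, neg_abs_le a, neg_abs_le b, le_abs_self a,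
            le_abs_self b]
  · filter_upwards [_root_.LocallyIntegrable.ae_hasDerivAt_integral hg] with x hx
    exact ((hx 0).const_add c).deriv

end LocAC

/-! ### Weak derivatives and absolutely continuous representatives -/

/-- A smooth compactly supported function with integral zero is the derivative of a smooth
compactly supported function. -/
theorem exists_deriv_eq_of_integral_eq_zero {φ : ℝ → ℝ} (hφ : ContDiff ℝ ∞ φ)
    (hc : HasCompactSupport φ) (h0 : ∫ x, φ x = 0) :
    ∃ Φ : ℝ → ℝ, ContDiff ℝ ∞ Φ ∧ HasCompactSupport Φ ∧ deriv Φ = φ := by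
  obtain ⟨M, hM0, hM⟩ := hc.exists_pos_le_norm
  have hi : Integrable φ := hφ.continuous.integrable_of_hasCompactSupport hc
  have hd : ∀ x, HasDerivAt (fun x => ∫ t in (-M)..x, φ t) (φ x) x := fun x =>
    intervalIntegral.integral_hasDerivAt_right hi.intervalIntegrable
      (hφ.continuous.stronglyMeasurableAtFilter _ _) hφ.continuous.continuousAt
  have hderiv : deriv (fun x => ∫ t in (-M)..x, φ t) = φ := funext fun x => (hd x).deriv
  refine ⟨fun x => ∫ t in (-M)..x, φ t, ?_, ?_, hderiv⟩
  · rw [contDiff_infty_iff_deriv, hderiv]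
    exact ⟨fun x => (hd x).differentiableAt, hφ⟩
  · refine HasCompactSupport.intro (K := Set.Icc (-M) M) isCompact_Icc fun x hx => ?_
    have hzero : ∀ t, M ≤ |t| → φ t = 0 := fun t ht => hM t ht
    rw [Set.mem_Icc, not_and_or, not_le, not_le] at hx
    rcases hx with hx | hx
    · rw [intervalIntegral.integral_congr (g := fun _ => (0 : ℝ))]
      · simp
      · intro t ht
        rw [Set.uIcc_of_ge hx.le] at ht
        refine hzero t ?_
        rw [abs_of_nonpos (by linarith [ht.2])]
        linarith [ht.2]
    · rw [← h0]
      refine intervalIntegral.integral_eq_integral_of_support_subset fun t ht => ?_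
      by_contra hcon
      apply ht
      apply hzero
      rw [Set.mem_Ioc, not_and_or, not_lt, not_le] at hcon
      rcases hcon with h | h
      · rw [abs_of_nonpos (by linarith)]; linarith
      · rw [abs_of_nonneg (by linarith)]; linarith

/-- The du Bois-Reymond lemma. -/
theorem ae_eq_const_of_integral_deriv_mul_eq_zero {h : ℝ → ℝ} (hh : LocallyIntegrable h)
    (h0 : ∀ φ : ℝ → ℝ, ContDiff ℝ ∞ φ → HasCompactSupport φ → ∫ x, deriv φ x * h x = 0) :
    ∃ c, ∀ᵐ x, h x = c := by
  let b : ContDiffBump (0 : ℝ) := default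
  set θ := b.normed volume with hθ
  have hθs : ContDiff ℝ ∞ θ := b.contDiff_normed
  have hθc : HasCompactSupport θ := b.hasCompactSupport_normed
  have hθi : ∫ x, θ x = 1 := b.integral_normed
  have hint : ∀ φ : ℝ → ℝ, Continuous φ → HasCompactSupport φ →
      Integrable fun x => φ x * h x := fun φ h1 h2 =>
    hh.integrable_smul_left_of_hasCompactSupport h1 h2
  have hintc : ∀ φ : ℝ → ℝ, Continuous φ → HasCompactSupport φ → Integrable φ := fun φ h1 h2 =>
    h1.integrable_of_hasCompactSupport h2
  refine ⟨∫ x, θ x * h x, ae_eq_of_integral_contDiff_smul_eq hh (locallyIntegrable_const _)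
    fun φ hφ hc => ?_⟩
  -- Subtracting a multiple of the normalized bump `θ` makes the integral vanish, so the result is
  -- the derivative of a test function.
  have hs : ContDiff ℝ ∞ (fun x => φ x - (∫ y, φ y) * θ x) := hφ.sub (contDiff_const.mul hθs)
  have hcs : HasCompactSupport (fun x => φ x - (∫ y, φ y) * θ x) := hc.sub hθc.mul_left
  obtain ⟨Φ, hΦ, hΦc, hΦd⟩ := exists_deriv_eq_of_integral_eq_zero hs hcs (by
    rw [integral_sub (hintc _ hφ.continuous hc) ((hintc _ hθs.continuous hθc).const_mul _),
      integral_const_mul, hθi, mul_one, sub_self])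
  have h1 := h0 Φ hΦ hΦc
  rw [hΦd] at h1
  have h2 : ∀ x, (φ x - (∫ y, φ y) * θ x) * h x = φ x * h x - (∫ y, φ y) * (θ x * h x) :=
    fun x => by ring
  simp only [h2] at h1
  rw [integral_sub (hint _ hφ.continuous hc) ((hint _ hθs.continuous hθc).const_mul _),
    integral_const_mul] at h1
  simp only [smul_eq_mul]
  rw [integral_mul_const]
  linarith

theorem locallyIntegrable_L2 (u : L2) : LocallyIntegrable (fun x => u x) (volume : Measure ℝ) :=
  (Lp.memLp u).locallyIntegrable (by norm_num)

/-- A function with a weak derivative has a locally absolutely continuous representative. -/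
theorem IsWeakDeriv.exists_locAC {f g : L2} (h : IsWeakDeriv f g) :
    ∃ F : ℝ → ℝ, LocAC F ∧ (∀ᵐ x, f x = F x) ∧ ∀ᵐ x, deriv F x = g x := by
  obtain ⟨hF, hFd⟩ := LocAC.of_integral (locallyIntegrable_L2 g) 0
  set F := fun x => 0 + ∫ t in (0 : ℝ)..x, g t with hFdef
  -- `f` and the primitive `F` of `g` have the same weak derivative, hence differ by a constant.
  obtain ⟨c, hc⟩ := ae_eq_const_of_integral_deriv_mul_eq_zero
    ((locallyIntegrable_L2 f).sub hF.continuous.locallyIntegrable) fun φ hφ hφc => by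
      have hφ1 : Continuous (deriv φ) := hφ.continuous_deriv (by simp)
      have hi : Integrable fun x => deriv φ x * F x :=
        (hφ1.mul hF.continuous).integrable_of_hasCompactSupport hφc.deriv.mul_right
      simp only [Pi.sub_apply, mul_sub]
      rw [integral_sub (integrable_test_mul f hφ1 hφc.deriv) hi,
        h φ hφ hφc, hF.integral_deriv_mul_test hφ hφc]
      rw [integral_congr_ae (hFd.mono fun x hx => congrArg (φ x * ·) hx)]
      simp
  obtain ⟨hG, hGd⟩ := LocAC.of_integral (locallyIntegrable_L2 g) c
  refine ⟨_, hG, ?_, hGd⟩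
  filter_upwards [hc] with x hx
  simp only [Pi.sub_apply, hFdef] at hx
  linarith

theorem inner_eq_integral (f g : L2) : inner ℝ f g = ∫ x, f x * g x := by
  rw [L2.inner_def]
  refine integral_congr_ae (Eventually.of_forall fun x => ?_)
  simp [mul_comm]

theorem integrable_mul_L2 (f g : L2) : Integrable fun x => f x * g x :=
  (Lp.memLp f).integrable_mul (Lp.memLp g)

/-- Weak differentiation is skew-symmetric on `H¹(ℝ)`. -/
theorem IsWeakDeriv.inner_left {f₁ g₁ f₂ g₂ : L2} (h₁ : IsWeakDeriv f₁ g₁)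
    (h₂ : IsWeakDeriv f₂ g₂) : inner ℝ g₁ f₂ = - inner ℝ f₁ g₂ := by
  obtain ⟨F, hF, hF0, hF1⟩ := h₁.exists_locAC
  obtain ⟨G, hG, hG0, hG1⟩ := h₂.exists_locAC
  have e1 : (fun x => g₁ x * f₂ x) =ᵐ[volume] fun x => deriv F x * G x := by
    filter_upwards [hF1, hG0] with x h1 h2
    rw [h1, h2]
  have e2 : (fun x => f₁ x * g₂ x) =ᵐ[volume] fun x => F x * deriv G x := by
    filter_upwards [hF0, hG1] with x h1 h2
    rw [h1, h2]
  have e3 : (fun x => f₁ x * f₂ x) =ᵐ[volume] fun x => F x * G x := by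
    filter_upwards [hF0, hG0] with x h1 h2
    rw [h1, h2]
  rw [inner_eq_integral, inner_eq_integral, integral_congr_ae e1, integral_congr_ae e2]
  exact hF.integral_deriv_mul_add_eq_zero hG ((integrable_mul_L2 _ _).congr e3)
    ((integrable_mul_L2 _ _).congr e1) ((integrable_mul_L2 _ _).congr e2)

/-- Cauchy–Schwarz against the indicator of `s`; on intervals it gives the Hölder-1/2 bound
`LocAC.sq_sub_le`. -/
theorem sq_setIntegral_le (g : L2) {s : Set ℝ} (hs : MeasurableSet s) (hμ : volume s ≠ ⊤) :
    (∫ x in s, g x) ^ 2 ≤ volume.real s * ‖g‖ ^ 2 := by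
  rw [← L2.inner_indicatorConstLp_one (𝕜 := ℝ) hs hμ g]
  have h1 := abs_real_inner_le_norm (indicatorConstLp 2 hs hμ (1 : ℝ)) g
  have h2 : ‖indicatorConstLp 2 hs hμ (1 : ℝ)‖ ^ 2 = volume.real s := by
    rw [norm_indicatorConstLp (by norm_num) (by norm_num)]
    simp only [norm_one, one_mul, ENNReal.toReal_ofNat, ← Real.sqrt_eq_rpow]
    exact Real.sq_sqrt measureReal_nonneg
  rw [← sq_abs, ← h2, ← mul_pow]
  exact pow_le_pow_left₀ (abs_nonneg _) h1 2

theorem LocAC.sq_sub_le {F : ℝ → ℝ} (hF : LocAC F) {g : L2} (hg : ∀ᵐ x, deriv F x = g x)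
    (x y : ℝ) : (F y - F x) ^ 2 ≤ |y - x| * ‖g‖ ^ 2 := by
  wlog hxy : x ≤ y generalizing x y
  · rw [abs_sub_comm, ← neg_sub, neg_sq]
    exact this y x (le_of_not_ge hxy)
  rw [← (hF x y).integral_deriv_eq_sub, intervalIntegral.integral_congr_ae (hg.mono fun _ h _ => h),
    intervalIntegral.integral_of_le hxy]
  refine (sq_setIntegral_le g measurableSet_Ioc measure_Ioc_lt_top.ne).trans_eq ?_
  rw [Real.volume_real_Ioc_of_le hxy, abs_of_nonneg (by linarith)]

/-! ### The potential as a bounded multiplication operator -/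

section Multiplication

variable (V : ℝ →ᵇ ℝ)

theorem coeFn_mulOp (f : L2) : ∀ᵐ x, mulOp V f x = V x * f x := (memLp_mul V f).coeFn_toLp

theorem inner_mulOp (f g : L2) : inner ℝ (mulOp V f) g = ∫ x, V x * (f x * g x) := by
  rw [inner_eq_integral]
  refine integral_congr_ae ((coeFn_mulOp V f).mono fun x hx => ?_)
  simp only [hx]
  ring

theorem inner_mulOp_comm (f g : L2) : inner ℝ (mulOp V f) g = inner ℝ f (mulOp V g) := by
  rw [real_inner_comm (mulOp V g) f, inner_mulOp, inner_mulOp]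
  exact integral_congr_ae (Eventually.of_forall fun x => by simp only; ring)

theorem inner_mulOp_nonneg {V : ℝ →ᵇ ℝ} (hV : ∀ x, 0 ≤ V x) (f : L2) :
    0 ≤ inner ℝ (mulOp V f) f := by
  rw [inner_mulOp]
  exact integral_nonneg fun x => mul_nonneg (hV x) (mul_self_nonneg _)

theorem norm_mulOp_le (f : L2) : ‖mulOp V f‖ ≤ ‖V‖ * ‖f‖ := by
  refine Lp.norm_le_mul_norm_of_ae_le_mul ((coeFn_mulOp V f).mono fun x hx => ?_)
  rw [hx, norm_mul]
  exact mul_le_mul_of_nonneg_right (V.norm_coe_le_norm x) (norm_nonneg _)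

theorem inner_mulOp_le (f g : L2) : |inner ℝ (mulOp V f) g| ≤ ‖V‖ * ‖f‖ * ‖g‖ :=
  (abs_real_inner_le_norm _ _).trans
    (mul_le_mul_of_nonneg_right (norm_mulOp_le V f) (norm_nonneg _))

theorem mulOp_zero_left (f : L2) : mulOp 0 f = 0 := by
  rw [← norm_le_zero_iff]
  simpa using norm_mulOp_le 0 f

end Multiplication

/-! ### The Schrödinger operator on `H²`: symmetry and positivity -/

section Domain

theorem IsWeakDeriv.sub {f₁ f₂ g₁ g₂ : L2} (h₁ : IsWeakDeriv f₁ g₁) (h₂ : IsWeakDeriv f₂ g₂) :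
    IsWeakDeriv (f₁ - f₂) (g₁ - g₂) := by
  have := h₁.add (h₂.smul (-1))
  rwa [neg_one_smul, neg_one_smul, ← sub_eq_add_neg, ← sub_eq_add_neg] at this

theorem exists_isWeakDeriv_of_mem_H2 (x : H2) :
    ∃ g, IsWeakDeriv x g ∧ IsWeakDeriv g (weakDeriv₂ x) :=
  ⟨weakDeriv ⟨x, H2_le_H1 x.2⟩, isWeakDeriv_weakDeriv ⟨x, H2_le_H1 x.2⟩,
    isWeakDeriv_weakDeriv ⟨weakDeriv ⟨x, H2_le_H1 x.2⟩, weakDeriv_mem_H1 x⟩⟩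

theorem IsWeakDeriv.mem_H2 {u g k : L2} (h₁ : IsWeakDeriv u g) (h₂ : IsWeakDeriv g k) :
    u ∈ H2 := by
  have hg : weakDeriv ⟨u, g, h₁⟩ = g := (isWeakDeriv_weakDeriv ⟨u, g, h₁⟩).unique h₁
  refine ⟨⟨u, g, h₁⟩, ?_, rfl⟩
  change weakDeriv ⟨u, g, h₁⟩ ∈ H1
  rw [hg]
  exact ⟨k, h₂⟩

theorem IsWeakDeriv.weakDeriv₂_eq {x : H2} {g k : L2} (h₁ : IsWeakDeriv x g)
    (h₂ : IsWeakDeriv g k) : weakDeriv₂ x = k := by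
  obtain ⟨g', h₁', h₂'⟩ := exists_isWeakDeriv_of_mem_H2 x
  rw [h₁'.unique h₁] at h₂'
  exact h₂'.unique h₂

theorem schrodinger_apply (V : ℝ →ᵇ ℝ) (x : (schrodinger V).domain) :
    schrodinger V x = -weakDeriv₂ x + mulOp V x := rfl

/-- Green's formula. -/
theorem inner_schrodinger (V : ℝ →ᵇ ℝ) (x : (schrodinger V).domain) {v g k : L2}
    (hx : IsWeakDeriv x g) (hv : IsWeakDeriv v k) :
    inner ℝ (schrodinger V x) v = inner ℝ g k + inner ℝ (mulOp V x) v := by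
  obtain ⟨g', h₁, h₂⟩ := exists_isWeakDeriv_of_mem_H2 x
  rw [h₁.unique hx] at h₂
  rw [schrodinger_apply, inner_add_left, inner_neg_left, h₂.inner_left hv, neg_neg]

theorem schrodinger_symm (V : ℝ →ᵇ ℝ) (x y : (schrodinger V).domain) :
    inner ℝ (schrodinger V x) (y : L2) = inner ℝ (x : L2) (schrodinger V y) := by
  obtain ⟨g, hg, -⟩ := exists_isWeakDeriv_of_mem_H2 x
  obtain ⟨k, hk, -⟩ := exists_isWeakDeriv_of_mem_H2 y
  rw [inner_schrodinger V x hg hk, real_inner_comm (schrodinger V y), inner_schrodinger V y hk hg,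
    inner_mulOp_comm, real_inner_comm g, real_inner_comm (x : L2)]

theorem schrodinger_nonneg {V : ℝ →ᵇ ℝ} (hV : ∀ x, 0 ≤ V x) (x : (schrodinger V).domain) :
    0 ≤ inner ℝ (schrodinger V x) (x : L2) := by
  obtain ⟨g, hg, -⟩ := exists_isWeakDeriv_of_mem_H2 x
  rw [inner_schrodinger V x hg hg]
  exact add_nonneg real_inner_self_nonneg (inner_mulOp_nonneg hV _)

end Domain

/-! ### Solving `u + S u = f` by Lax–Milgram -/

section DerivGraph

/-- The graph of the weak derivative on `H¹(ℝ)`. -/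
noncomputable def derivGraph : Submodule ℝ (WithLp 2 (L2 × L2)) where
  carrier := {p | IsWeakDeriv p.fst p.snd}
  add_mem' h₁ h₂ := IsWeakDeriv.add h₁ h₂
  zero_mem' := isWeakDeriv_zero
  smul_mem' c _ h := IsWeakDeriv.smul c h

theorem mem_derivGraph {p : WithLp 2 (L2 × L2)} : p ∈ derivGraph ↔ IsWeakDeriv p.fst p.snd :=
  Iff.rfl

theorem memLp_test {φ : ℝ → ℝ} (hφ : Continuous φ) (hc : HasCompactSupport φ) :
    MemLp φ 2 (volume : Measure ℝ) :=
  hφ.memLp_of_hasCompactSupport hc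

theorem inner_toLp_test {φ : ℝ → ℝ} (hφ : MemLp φ 2 (volume : Measure ℝ)) (f : L2) :
    inner ℝ (hφ.toLp) f = ∫ x, φ x * f x := by
  rw [inner_eq_integral]
  exact integral_congr_ae (hφ.coeFn_toLp.mono fun x hx => by simp only [hx])

/-- Each test function imposes a closed condition. Hence `H¹`, modelled as this graph with the norm
of `L² × L²`, is a Hilbert space. -/
theorem isClosed_derivGraph : IsClosed (derivGraph : Set (WithLp 2 (L2 × L2))) := by
  have h : (derivGraph : Set (WithLp 2 (L2 × L2))) = ⋂ (φ : ℝ → ℝ) (_ : ContDiff ℝ ∞ φ)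
      (_ : HasCompactSupport φ),
      {p | ∫ x, deriv φ x * p.fst x = - ∫ x, φ x * p.snd x} := by
    ext p
    simp only [Set.mem_iInter]
    exact Iff.rfl
  rw [h]
  refine isClosed_iInter fun φ => isClosed_iInter fun hφ => isClosed_iInter fun hc => ?_
  have e1 := inner_toLp_test (memLp_test (hφ.continuous_deriv (by simp)) hc.deriv)
  have e2 := inner_toLp_test (memLp_test hφ.continuous hc)
  simp only [← e1, ← e2]
  exact isClosed_eq (by fun_prop) (by fun_prop)

instance : CompleteSpace derivGraph := isClosed_derivGraph.completeSpace_coe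

theorem isWeakDeriv_test {φ : ℝ → ℝ} (hφ : ContDiff ℝ ∞ φ) (hc : HasCompactSupport φ) :
    IsWeakDeriv ((memLp_test hφ.continuous hc).toLp)
      ((memLp_test (hφ.continuous_deriv (by simp)) hc.deriv).toLp) := by
  intro χ hχ hχc
  have h := (hφ.of_le (by exact_mod_cast le_top : (1 : WithTop ℕ∞) ≤ ∞)).locAC.integral_deriv_mul_test
    hχ hχc
  rw [integral_congr_ae ((memLp_test hφ.continuous hc).coeFn_toLp.mono
      fun x hx => congrArg (deriv χ x * ·) hx), h,
    integral_congr_ae ((memLp_test (hφ.continuous_deriv (by simp)) hc.deriv).coeFn_toLp.mono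
      fun x hx => congrArg (χ x * ·) hx)]

/-- Lax–Milgram for the form `⟪u', v'⟫ + ⟪u, v⟫ + ⟪V u, v⟫` on `H¹(ℝ)`. -/
theorem exists_weak_solution {V : ℝ →ᵇ ℝ} (hV : ∀ x, 0 ≤ V x) (f : L2) :
    ∃ u g : L2, IsWeakDeriv u g ∧ ∀ v k : L2, IsWeakDeriv v k →
      inner ℝ u v + inner ℝ g k + inner ℝ (mulOp V u) v = inner ℝ f v := by
  let B : derivGraph →L[ℝ] derivGraph →L[ℝ] ℝ := LinearMap.mkContinuous₂
    (LinearMap.mk₂ ℝ (fun p q : derivGraph => inner ℝ p q +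
      inner ℝ (mulOp V (p : WithLp 2 (L2 × L2)).fst) (q : WithLp 2 (L2 × L2)).fst)
      (fun p p' q => by simp [inner_add_left]; ring)
      (fun c p q => by simp [inner_smul_left]; ring)
      (fun p q q' => by simp [inner_add_right]; ring)
      (fun c p q => by simp [inner_smul_right]; ring)) (1 + ‖V‖) (fun p q => by
        have h1 := norm_inner_le_norm (𝕜 := ℝ) p q
        have h2 := inner_mulOp_le V (p : WithLp 2 (L2 × L2)).fst (q : WithLp 2 (L2 × L2)).fst
        have h3 : ‖(p : WithLp 2 (L2 × L2)).fst‖ ≤ ‖p‖ := WithLp.norm_fst_le _ _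
        have h4 : ‖(q : WithLp 2 (L2 × L2)).fst‖ ≤ ‖q‖ := WithLp.norm_fst_le _ _
        refine (norm_add_le _ _).trans ?_
        have h5 : ‖V‖ * ‖(p : WithLp 2 (L2 × L2)).fst‖ * ‖(q : WithLp 2 (L2 × L2)).fst‖ ≤
            ‖V‖ * ‖p‖ * ‖q‖ := by gcongr
        rw [Real.norm_eq_abs (inner ℝ (mulOp V _) _)]
        linarith)
  have hB : ∀ p q : derivGraph, B p q = inner ℝ p q +
      inner ℝ (mulOp V (p : WithLp 2 (L2 × L2)).fst) (q : WithLp 2 (L2 × L2)).fst :=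
    fun _ _ => rfl
  have hcoer : IsCoercive B := by
    -- The graph inner product already equals `⟪u, v⟫ + ⟪u', v'⟫`, so coercivity with constant 1
    -- needs only `V ≥ 0`.
    refine ⟨1, one_pos, fun p => ?_⟩
    rw [hB, real_inner_self_eq_norm_mul_norm, one_mul]
    linarith [inner_mulOp_nonneg hV (p : WithLp 2 (L2 × L2)).fst]
  let ℓ : derivGraph →L[ℝ] ℝ :=
    (innerSL ℝ f).comp ((WithLp.fstL 2 ℝ L2 L2).comp derivGraph.subtypeL)
  let p := hcoer.continuousLinearEquivOfBilin.symm ((InnerProductSpace.toDual ℝ derivGraph).symm ℓ)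
  have hp : ∀ q : derivGraph, B p q = inner ℝ f (q : WithLp 2 (L2 × L2)).fst := by
    intro q
    rw [← hcoer.continuousLinearEquivOfBilin_apply, ContinuousLinearEquiv.apply_symm_apply,
      InnerProductSpace.toDual_symm_apply]
    rfl
  refine ⟨(p : WithLp 2 (L2 × L2)).fst, (p : WithLp 2 (L2 × L2)).snd, p.2, fun v k hvk => ?_⟩
  have h1 := hp ⟨WithLp.toLp 2 (v, k), hvk⟩
  rw [hB, Submodule.coe_inner, WithLp.prod_inner_apply] at h1
  exact h1

theorem exists_add_schrodinger_eq {V : ℝ →ᵇ ℝ} (hV : ∀ x, 0 ≤ V x) (f : L2) :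
    ∃ x : (schrodinger V).domain, (x : L2) + schrodinger V x = f := by
  obtain ⟨u, g, hug, h⟩ := exists_weak_solution hV f
  -- Testing the weak equation with smooth `φ` identifies `u''`, which puts `u` in `H²`.
  have hg : IsWeakDeriv g (u + mulOp V u - f) := by
    intro φ hφ hc
    have h1 := h _ _ (isWeakDeriv_test hφ hc)
    rw [← inner_toLp_test (memLp_test (hφ.continuous_deriv (by simp)) hc.deriv),
      ← inner_toLp_test (memLp_test hφ.continuous hc), real_inner_comm, real_inner_comm
        (u + mulOp V u - f), inner_sub_left, inner_add_left]
    linarith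
  refine ⟨⟨u, hug.mem_H2 hg⟩, ?_⟩
  change u + (-weakDeriv₂ (⟨u, hug.mem_H2 hg⟩ : H2) + mulOp V u) = f
  rw [IsWeakDeriv.weakDeriv₂_eq (x := ⟨u, hug.mem_H2 hg⟩) hug hg]
  abel

theorem isNonnegSqrt_nonnegSqrt_schrodinger {V : ℝ →ᵇ ℝ} (hV : ∀ x, 0 ≤ V x) :
    IsNonnegSqrt (schrodinger V) (nonnegSqrt (schrodinger V)) :=
  Classical.epsilon_spec (exists_isNonnegSqrt (schrodinger V) (schrodinger_symm V)
    (schrodinger_nonneg hV) (exists_add_schrodinger_eq hV))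

end DerivGraph

/-! ### The domain of the square root is `H¹` -/

section FormDomain

/-- Criterion for a core: decompose along the closure of `K` and its orthogonal complement; the
orthogonal component stays in `Γ` and vanishes by hypothesis. -/
theorem le_topologicalClosure_of_inner_eq_zero {H : Type*} [NormedAddCommGroup H]
    [InnerProductSpace ℝ H] [CompleteSpace H] {Γ K : Submodule ℝ H} (hΓ : IsClosed (Γ : Set H))
    (hK : K ≤ Γ) (h : ∀ p ∈ Γ, (∀ k ∈ K, inner ℝ k p = 0) → p = 0) :
    Γ ≤ K.topologicalClosure := by
  intro p hp
  have : CompleteSpace K.topologicalClosure := K.isClosed_topologicalClosure.completeSpace_coe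
  obtain ⟨y, hy, z, hz, rfl⟩ := K.topologicalClosure.exists_add_mem_mem_orthogonal p
  have hyΓ : y ∈ Γ := K.topologicalClosure_minimal hK hΓ hy
  have hzΓ : z ∈ Γ := by simpa using Γ.sub_mem hp hyΓ
  have hz0 : z = 0 := h z hzΓ fun k hk => hz k (K.le_topologicalClosure hk)
  rwa [hz0, add_zero]

theorem cauchySeq_of_sq_norm_sub_le {E F : Type*} [NormedAddCommGroup E] [NormedAddCommGroup F]
    {u : ℕ → E} {v : ℕ → F} {C : ℝ} (hu : CauchySeq u)
    (h : ∀ n m, ‖v n - v m‖ ^ 2 ≤ C * ‖u n - u m‖ ^ 2) : CauchySeq v := by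
  rw [cauchySeq_iff_tendsto_dist_atTop_0] at hu ⊢
  have h1 : Tendsto (fun n : ℕ × ℕ => Real.sqrt (C * dist (u n.1) (u n.2) ^ 2)) atTop (𝓝 0) := by
    have := ((hu.pow 2).const_mul C).sqrt
    simpa using this
  refine squeeze_zero (fun _ => dist_nonneg) (fun n => ?_) h1
  rw [dist_eq_norm, dist_eq_norm]
  exact Real.le_sqrt_of_sq_le (h n.1 n.2)

/-- The graph inner product of `x ∈ H²` with `v ∈ H¹` is `⟪x - x'', v⟫`. Solving `x - x'' = v` shows
that a `v` orthogonal to all such `x` is zero. -/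
theorem derivGraph_le_closure :
    derivGraph ≤ (derivGraph ⊓ H2.comap (WithLp.fstₗ 2 ℝ L2 L2)).topologicalClosure := by
  refine le_topologicalClosure_of_inner_eq_zero isClosed_derivGraph inf_le_left fun p hp h => ?_
  obtain ⟨x, hx⟩ := exists_add_schrodinger_eq (V := 0) (fun _ => le_rfl) p.fst
  obtain ⟨g, hg, -⟩ := exists_isWeakDeriv_of_mem_H2 x
  have h1 := h (WithLp.toLp 2 ((x : L2), g)) ⟨hg, x.2⟩
  rw [WithLp.prod_inner_apply] at h1
  have h2 := inner_schrodinger 0 x hg hp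
  rw [mulOp_zero_left, inner_zero_left, add_zero] at h2
  have h3 : inner ℝ p.fst p.fst = 0 := by
    nth_rewrite 1 [← hx]
    rw [inner_add_left, h2]
    exact h1
  have h4 : p.fst = 0 := inner_self_eq_zero.1 h3
  have h5 : p.snd = 0 := by
    rw [mem_derivGraph, h4] at hp
    exact hp.unique isWeakDeriv_zero
  exact WithLp.ofLp_injective 2 (Prod.ext h4 h5)

variable {V : ℝ →ᵇ ℝ} {T : L2 →ₗ.[ℝ] L2}

theorem IsNonnegSqrt.inner_graph {E : Type*} [NormedAddCommGroup E] [InnerProductSpace ℝ E]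
    [CompleteSpace E] {A T : E →ₗ.[ℝ] E} (hT : IsNonnegSqrt A T) {a b c d : E}
    (h : (a, b) ∈ T.graph) (h' : (c, d) ∈ T.graph) : inner ℝ b c = inner ℝ a d := by
  have h1 := LinearPMap.adjoint_graph_eq_graph_adjoint hT.isSelfAdjoint.dense_domain
  rw [LinearPMap.isSelfAdjoint_def.1 hT.isSelfAdjoint] at h1
  rw [h1, Submodule.mem_adjoint_iff] at h'
  exact sub_eq_zero.1 (h' a b h)

theorem IsNonnegSqrt.exists_graph (hT : IsNonnegSqrt (schrodinger V) T)
    (x : (schrodinger V).domain) :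
    ∃ z, ((x : L2), z) ∈ T.graph ∧ (z, schrodinger V x) ∈ T.graph :=
  (hT.sq_eq _ _).1 ((schrodinger V).mem_graph x)

/-- `‖T x‖² = ⟪x, T² x⟫ = ⟪x, S x⟫`, followed by Green's formula. -/
theorem IsNonnegSqrt.norm_sq_of_mem_H2 (hT : IsNonnegSqrt (schrodinger V) T) {x g z : L2}
    (hx : x ∈ H2) (hg : IsWeakDeriv x g) (hz : (x, z) ∈ T.graph) :
    ‖z‖ ^ 2 = ‖g‖ ^ 2 + inner ℝ (mulOp V x) x := by
  obtain ⟨w, hw, hw'⟩ := hT.exists_graph ⟨x, hx⟩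
  have hzw : z = w := T.mem_graph_snd_inj hz hw rfl
  subst hzw
  rw [← real_inner_self_eq_norm_sq, ← real_inner_self_eq_norm_sq, hT.inner_graph hz hw',
    real_inner_comm]
  exact inner_schrodinger V ⟨x, hx⟩ hg hg

/-- The graph of `T` as a subspace of the Hilbert space `E × E`. -/
noncomputable def graphL2 {E : Type*} [NormedAddCommGroup E] [InnerProductSpace ℝ E]
    (T : E →ₗ.[ℝ] E) : Submodule ℝ (WithLp 2 (E × E)) :=
  T.graph.comap (WithLp.linearEquiv 2 ℝ (E × E)).toLinearMap

theorem IsNonnegSqrt.isClosed_graphL2 {A : L2 →ₗ.[ℝ] L2} (hT : IsNonnegSqrt A T) :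
    IsClosed (graphL2 T : Set (WithLp 2 (L2 × L2))) :=
  IsClosed.preimage (WithLp.prod_continuous_ofLp 2 L2 L2) hT.isSelfAdjoint.isClosed

/-- The argument of `derivGraph_le_closure` with `T` in place of the derivative: `⟪x, p⟫ + ⟪T x, T
p⟫ = ⟪x + S x, p⟫`, and `1 + S` is onto. -/
theorem IsNonnegSqrt.graphL2_le_closure (hV : ∀ x, 0 ≤ V x)
    (hT : IsNonnegSqrt (schrodinger V) T) :
    graphL2 T ≤ (graphL2 T ⊓ H2.comap (WithLp.fstₗ 2 ℝ L2 L2)).topologicalClosure := by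
  refine le_topologicalClosure_of_inner_eq_zero hT.isClosed_graphL2 inf_le_left fun p hp h => ?_
  obtain ⟨x, hx⟩ := exists_add_schrodinger_eq hV p.fst
  obtain ⟨z, hz, hz'⟩ := hT.exists_graph x
  have hp' : (p.fst, p.snd) ∈ T.graph := hp
  have h1 := h (WithLp.toLp 2 ((x : L2), z)) ⟨hz, x.2⟩
  rw [WithLp.prod_inner_apply] at h1
  have h2 := hT.inner_graph hz' hp'
  have h3 : inner ℝ p.fst p.fst = 0 := by
    nth_rewrite 1 [← hx]
    rw [inner_add_left, h2]
    exact h1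
  have h4 : p.fst = 0 := inner_self_eq_zero.1 h3
  have h5 : p.snd = 0 := T.graph_fst_eq_zero_snd hp' h4
  exact WithLp.ofLp_injective 2 (Prod.ext h4 h5)

/-- `H¹(ℝ)` is contained in the domain of the square root, which computes the quadratic form. -/
theorem IsNonnegSqrt.exists_graph_of_isWeakDeriv (hT : IsNonnegSqrt (schrodinger V) T) {u g : L2}
    (hu : IsWeakDeriv u g) :
    ∃ z, (u, z) ∈ T.graph ∧ ‖z‖ ^ 2 = ‖g‖ ^ 2 + inner ℝ (mulOp V u) u := by
  have hmem : WithLp.toLp 2 (u, g) ∈ derivGraph := hu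
  obtain ⟨k, hk, hlim⟩ := mem_closure_iff_seq_limit.1 (derivGraph_le_closure hmem)
  have hfst : Tendsto (fun n => (k n).fst) atTop (𝓝 u) :=
    ((WithLp.fstL 2 ℝ L2 L2).continuous.tendsto _).comp hlim
  have hsnd : Tendsto (fun n => (k n).snd) atTop (𝓝 g) :=
    ((WithLp.sndL 2 ℝ L2 L2).continuous.tendsto _).comp hlim
  choose z hz _ using fun n => hT.exists_graph ⟨(k n).fst, (hk n).2⟩
  simp only at hz
  -- The form identity on `H²`, applied to differences, makes the images under `T` a Cauchy
  -- sequence; closedness of `T` then identifies the limit.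
  have hsq : ∀ n m, ‖z n - z m‖ ^ 2 ≤ (1 + ‖V‖) * ‖k n - k m‖ ^ 2 := by
    intro n m
    have hd : k n - k m ∈ derivGraph ⊓ H2.comap (WithLp.fstₗ 2 ℝ L2 L2) :=
      Submodule.sub_mem _ (hk n) (hk m)
    have hzd : (((k n).fst, z n) - ((k m).fst, z m) : L2 × L2) ∈ T.graph :=
      T.graph.sub_mem (hz n) (hz m)
    rw [hT.norm_sq_of_mem_H2 (x := (k n - k m).fst) hd.2 hd.1 hzd,
      WithLp.prod_norm_sq_eq_of_L2]
    have h1 := (le_abs_self _).trans (inner_mulOp_le V (k n - k m).fst (k n - k m).fst)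
    have h2 : 0 ≤ ‖V‖ * ‖(k n - k m).snd‖ ^ 2 := by positivity
    nlinarith [sq_nonneg ‖(k n - k m).fst‖]
  obtain ⟨w, hw⟩ := cauchySeq_tendsto_of_complete (cauchySeq_of_sq_norm_sub_le hlim.cauchySeq hsq)
  refine ⟨w, ?_, ?_⟩
  · exact hT.isSelfAdjoint.isClosed.mem_of_tendsto (hfst.prodMk_nhds hw) (Eventually.of_forall hz)
  · have hM : Continuous (mulOp V) :=
      ((mulOp V).mkContinuous ‖V‖ (norm_mulOp_le V)).continuous
    refine tendsto_nhds_unique (hw.norm.pow 2) (((hsnd.norm.pow 2).add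
      (((hM.tendsto u).comp hfst).inner hfst)).congr fun n => ?_)
    exact (hT.norm_sq_of_mem_H2 (hk n).2 (hk n).1 (hz n)).symm

/-- For an approximating sequence in `H²`, positivity of `V` gives `‖x'‖ ≤ ‖T x‖` on differences, so
the derivatives converge too. -/
theorem IsNonnegSqrt.exists_isWeakDeriv_of_graph (hV : ∀ x, 0 ≤ V x)
    (hT : IsNonnegSqrt (schrodinger V) T) {u z : L2} (hz : (u, z) ∈ T.graph) :
    ∃ g, IsWeakDeriv u g := by
  have hmem : WithLp.toLp 2 (u, z) ∈ graphL2 T := hz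
  obtain ⟨k, hk, hlim⟩ := mem_closure_iff_seq_limit.1 (hT.graphL2_le_closure hV hmem)
  have hfst : Tendsto (fun n => (k n).fst) atTop (𝓝 u) :=
    ((WithLp.fstL 2 ℝ L2 L2).continuous.tendsto _).comp hlim
  choose g hg _ using fun n => exists_isWeakDeriv_of_mem_H2 ⟨(k n).fst, (hk n).2⟩
  simp only at hg
  have hsq : ∀ n m, ‖g n - g m‖ ^ 2 ≤ 1 * ‖k n - k m‖ ^ 2 := by
    intro n m
    have hd : k n - k m ∈ graphL2 T ⊓ H2.comap (WithLp.fstₗ 2 ℝ L2 L2) :=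
      Submodule.sub_mem _ (hk n) (hk m)
    have h1 := hT.norm_sq_of_mem_H2 (x := (k n - k m).fst) (z := (k n - k m).snd) hd.2
      ((hg n).sub (hg m)) hd.1
    rw [WithLp.prod_norm_sq_eq_of_L2, h1]
    linarith [inner_mulOp_nonneg hV (k n - k m).fst, sq_nonneg ‖(k n - k m).fst‖]
  obtain ⟨w, hw⟩ := cauchySeq_tendsto_of_complete (cauchySeq_of_sq_norm_sub_le hlim.cauchySeq hsq)
  refine ⟨w, ?_⟩
  have h1 : Tendsto (fun n => WithLp.toLp 2 ((k n).fst, g n)) atTop (𝓝 (WithLp.toLp 2 (u, w))) :=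
    ((WithLp.prod_continuous_toLp 2 L2 L2).tendsto _).comp (hfst.prodMk_nhds hw)
  exact isClosed_derivGraph.mem_of_tendsto h1 (Eventually.of_forall hg)

theorem domain_nonnegSqrt_schrodinger (hV : ∀ x, 0 ≤ V x) :
    (nonnegSqrt (schrodinger V)).domain = H1 := by
  have hT := isNonnegSqrt_nonnegSqrt_schrodinger hV
  ext u
  constructor
  · intro hu
    exact hT.exists_isWeakDeriv_of_graph hV ((nonnegSqrt (schrodinger V)).mem_graph ⟨u, hu⟩)
  · rintro ⟨g, hg⟩
    obtain ⟨z, hz, -⟩ := hT.exists_graph_of_isWeakDeriv hg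
    exact LinearPMap.mem_domain_of_mem_graph hz

theorem norm_sq_nonnegSqrt_schrodinger (hV : ∀ x, 0 ≤ V x)
    (f : (nonnegSqrt (schrodinger V)).domain) :
    ∃ g, IsWeakDeriv f g ∧
      ‖nonnegSqrt (schrodinger V) f‖ ^ 2 = ‖g‖ ^ 2 + inner ℝ (mulOp V f) (f : L2) := by
  have hT := isNonnegSqrt_nonnegSqrt_schrodinger hV
  have hf := (nonnegSqrt (schrodinger V)).mem_graph f
  obtain ⟨g, hg⟩ := hT.exists_isWeakDeriv_of_graph hV hf
  obtain ⟨z, hz, hzn⟩ := hT.exists_graph_of_isWeakDeriv hg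
  refine ⟨g, hg, ?_⟩
  rw [← hzn, (nonnegSqrt (schrodinger V)).mem_graph_snd_inj hz hf rfl]

end FormDomain

/-! ### Linear growth of the weight -/

section Solutions

/-- An increasing solution of `ψ'' = V ψ` that tends to `1` at `-∞` grows at least linearly. -/
theorem exists_linear_lower_bound {V ψ : ℝ → ℝ} (hV : ∀ x, 0 ≤ V x) (hne : ∃ x, V x ≠ 0)
    (hd : Differentiable ℝ ψ) (hdd : ∀ x, HasDerivAt (deriv ψ) (V x * ψ x) x) (hm : Monotone ψ)
    (ht : Tendsto ψ atBot (𝓝 1)) :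
    (∀ x, 1 ≤ ψ x) ∧ ∃ c > 0, ∃ a, ∀ x, c * (x - a) ≤ ψ x := by
  have h1 : ∀ x, 1 ≤ ψ x := fun x => hm.le_of_tendsto ht x
  refine ⟨h1, ?_⟩
  have hmono : Monotone (deriv ψ) := by
    refine monotone_of_deriv_nonneg (fun x => (hdd x).differentiableAt) fun x => ?_
    rw [(hdd x).deriv]
    exact mul_nonneg (hV x) (zero_le_one.trans (h1 x))
  -- `ψ` is convex; were its slope never positive, `ψ' = 0` would force `V ψ = 0`, against `ψ ≥ 1`
  -- and `V ≠ 0`.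
  have hpos : ∃ a, 0 < deriv ψ a := by
    by_contra! h
    obtain ⟨x, hx⟩ := hne
    have h0 : deriv ψ = fun _ => 0 := funext fun y => le_antisymm (h y) hm.deriv_nonneg
    have h2 := hdd x
    rw [h0] at h2
    have h3 := h2.unique (hasDerivAt_const x (0 : ℝ))
    rcases mul_eq_zero.1 h3 with h4 | h4
    · exact hx h4
    · linarith [h1 x]
  obtain ⟨a, ha⟩ := hpos
  refine ⟨deriv ψ a, ha, a, fun x => ?_⟩
  rcases le_total x a with hx | hx
  · nlinarith [h1 x]
  · have h2 := (convex_Ici a).mul_sub_le_image_sub_of_le_deriv hd.continuous.continuousOn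
      hd.differentiableOn (C := deriv ψ a) (fun y hy => by
        rw [interior_Ici] at hy
        exact hmono (le_of_lt hy)) a Set.self_mem_Ici x hx hx
    linarith [h1 a]

theorem exists_ne_zero_of_mem_potentialClass {V : ℝ →ᵇ ℝ} (hV : V ∈ potentialClass) :
    ∃ x, V x ≠ 0 := by
  by_contra! h
  have h2 := hV.2.2
  simp [h] at h2

/-- The weight `ψ₁ + ψ₂` grows at least linearly in both directions. -/
theorem IsHarmonicPair.exists_weight_le {V : ℝ →ᵇ ℝ} (hV : V ∈ potentialClass) {ψ₁ ψ₂ : ℝ → ℝ}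
    (hψ : IsHarmonicPair V ψ₁ ψ₂) : ∃ L > 0, ∀ x, 1 + |x| ≤ L * (ψ₁ x + ψ₂ x) := by
  obtain ⟨y, hy⟩ := exists_ne_zero_of_mem_potentialClass hV
  obtain ⟨h1, c, hc, a, ha⟩ := exists_linear_lower_bound hV.1 ⟨y, hy⟩ hψ.solution₁.1
    hψ.solution₁.2 hψ.monotone₁ hψ.tendsto₁
  -- The reflection of `ψ₂` is an increasing solution for the potential `V (-x)`.
  have hneg : ∀ x, HasDerivAt (fun x => ψ₂ (-x)) (-deriv ψ₂ (-x)) x := fun x => by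
    simpa [Function.comp_def] using (hψ.solution₂.1 (-x)).hasDerivAt.scomp x (hasDerivAt_neg x)
  have hneg' : deriv (fun x => ψ₂ (-x)) = fun x => -deriv ψ₂ (-x) :=
    funext fun x => (hneg x).deriv
  obtain ⟨h2, d, hd, b, hb⟩ := exists_linear_lower_bound (V := fun x => V (-x))
    (ψ := fun x => ψ₂ (-x)) (fun x => hV.1 _) ⟨-y, by simpa using hy⟩
    (fun x => (hneg x).differentiableAt) (fun x => by
      rw [hneg']
      simpa [Function.comp_def] using ((hψ.solution₂.2 (-x)).scomp x (hasDerivAt_neg x)).fun_neg)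
    (fun x x' h => hψ.antitone₂ (neg_le_neg h)) (hψ.tendsto₂.comp tendsto_neg_atBot_atTop)
  have h2' : ∀ x, 1 ≤ ψ₂ x := fun x => by simpa using h2 (-x)
  have hb' : ∀ x, d * (-x - b) ≤ ψ₂ x := fun x => by simpa using hb (-x)
  refine ⟨1 + (1 / c + |a|) + (1 / d + |b|), by positivity, fun x => ?_⟩
  have e1 : x ≤ (1 / c + |a|) * ψ₁ x := by
    have h3 : x - a ≤ ψ₁ x / c := by rw [le_div_iff₀ hc, mul_comm]; exact ha x
    have h4 : |a| ≤ |a| * ψ₁ x := le_mul_of_one_le_right (abs_nonneg a) (h1 x)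
    have h5 : (1 / c + |a|) * ψ₁ x = ψ₁ x / c + |a| * ψ₁ x := by ring
    linarith [le_abs_self a]
  have e2 : -x ≤ (1 / d + |b|) * ψ₂ x := by
    have h3 : -x - b ≤ ψ₂ x / d := by rw [le_div_iff₀ hd, mul_comm]; exact hb' x
    have h4 : |b| ≤ |b| * ψ₂ x := le_mul_of_one_le_right (abs_nonneg b) (h2' x)
    have h5 : (1 / d + |b|) * ψ₂ x = ψ₂ x / d + |b| * ψ₂ x := by ring
    linarith [le_abs_self b]
  have p1 : 0 ≤ 1 / c + |a| := by positivity
  have p2 : 0 ≤ 1 / d + |b| := by positivity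
  have q1 := h1 x
  have q2 := h2' x
  have r1 : 0 ≤ (1 / c + |a|) * ψ₁ x := mul_nonneg p1 (by linarith)
  have r2 : 0 ≤ (1 / d + |b|) * ψ₂ x := mul_nonneg p2 (by linarith)
  have r3 : 0 ≤ (1 / c + |a|) * ψ₂ x := mul_nonneg p1 (by linarith)
  have r4 : 0 ≤ (1 / d + |b|) * ψ₁ x := mul_nonneg p2 (by linarith)
  have habs : |x| ≤ (1 / c + |a|) * ψ₁ x + (1 / d + |b|) * ψ₂ x :=
    abs_le.2 ⟨by linarith, by linarith⟩
  nlinarith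

end Solutions

/-! ### Pointwise bound, Hardy inequality and Nash inequality -/

section Nash

theorem integrable_of_mem_potentialClass {V : ℝ →ᵇ ℝ} (hV : V ∈ potentialClass) :
    Integrable fun x => V x := by
  have h1 : Integrable (Set.indicator (Set.Icc (-1 : ℝ) 1) fun _ => ‖V‖) :=
    (integrable_indicator_iff measurableSet_Icc).2 (integrableOn_const measure_Icc_lt_top.ne)
  refine (h1.add hV.2.1).mono' V.continuous.aestronglyMeasurable
    (Eventually.of_forall fun x => ?_)
  rw [Real.norm_of_nonneg (hV.1 x), Pi.add_apply]
  have h2 : V x ≤ ‖V‖ := (le_abs_self _).trans (V.norm_coe_le_norm x)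
  have h3 := hV.1 x
  by_cases hx : x ∈ Set.Icc (-1 : ℝ) 1
  · rw [Set.indicator_of_mem hx]
    have := mul_nonneg (abs_nonneg x) h3
    linarith
  · rw [Set.indicator_of_notMem hx, zero_add]
    refine le_mul_of_one_le_left h3 ?_
    by_contra hcon
    exact hx (abs_le.1 (le_of_lt (not_le.1 hcon)))

theorem integral_pos_of_mem_potentialClass {V : ℝ →ᵇ ℝ} (hV : V ∈ potentialClass) :
    0 < ∫ x, V x := by
  obtain ⟨y, hy⟩ := exists_ne_zero_of_mem_potentialClass hV
  exact integral_pos_of_integrable_nonneg_nonzero V.continuous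
    (integrable_of_mem_potentialClass hV) hV.1 hy

variable {F : ℝ → ℝ} {g : L2}

theorem integrable_bdd_mul_sq (V : ℝ →ᵇ ℝ) (hF2 : Integrable fun x => F x * F x) :
    Integrable fun x => V x * (F x * F x) :=
  hF2.bdd_mul V.continuous.aestronglyMeasurable (Eventually.of_forall V.norm_coe_le_norm)

/-- The quadratic form controls `F` pointwise, with square-root growth. -/
theorem exists_sq_le_mul_form {V : ℝ →ᵇ ℝ} (hV : V ∈ potentialClass) :
    ∃ K > 0, ∀ (F : ℝ → ℝ) (g : L2), LocAC F → (∀ᵐ x, deriv F x = g x) →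
      (Integrable fun x => F x * F x) →
      ∀ x, F x ^ 2 ≤ K * (‖g‖ ^ 2 + ∫ y, V y * (F y * F y)) * (1 + |x|) := by
  set v₀ := ∫ y, V y with hv₀
  set v₁ := ∫ y, |y| * V y with hv₁
  have hp0 : 0 < v₀ := integral_pos_of_mem_potentialClass hV
  have hp1 : 0 < v₁ := hV.2.2
  refine ⟨2 * (1 + v₀ + v₁) / v₀, by positivity, fun F g hF hg hF2 x => ?_⟩
  set p := ∫ y, V y * (F y * F y) with hp
  have hpn : 0 ≤ p := integral_nonneg fun y => mul_nonneg (hV.1 y) (mul_self_nonneg _)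
  have hVi := integrable_of_mem_potentialClass hV
  have hVF := integrable_bdd_mul_sq V hF2
  -- `F(x)² ≤ 2 F(y)² + 2 |y - x| ‖g‖²` is averaged against `V(y) dy`; finiteness of `∫ |y| V`
  -- controls the last term.
  have hpt : ∀ y, F x ^ 2 * V y ≤ 2 * (V y * (F y * F y)) + (2 * |x| * ‖g‖ ^ 2 * V y +
      2 * ‖g‖ ^ 2 * (|y| * V y)) := by
    intro y
    have h1 := hF.sq_sub_le hg x y
    have h2 : |y - x| ≤ |y| + |x| := abs_sub _ _
    have h3 : F x ^ 2 ≤ 2 * (F y * F y) + 2 * ((|y| + |x|) * ‖g‖ ^ 2) := by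
      have h4 := mul_le_mul_of_nonneg_right h2 (sq_nonneg ‖g‖)
      nlinarith [sq_nonneg (2 * F y - F x)]
    have h5 := mul_le_mul_of_nonneg_right h3 (hV.1 y)
    linarith
  have hW : Integrable fun y => 2 * |x| * ‖g‖ ^ 2 * V y + 2 * ‖g‖ ^ 2 * (|y| * V y) :=
    (hVi.const_mul (2 * |x| * ‖g‖ ^ 2)).add (hV.2.1.const_mul (2 * ‖g‖ ^ 2))
  have hI := integral_mono (hVi.const_mul (F x ^ 2)) ((hVF.const_mul 2).add hW) hpt
  simp only [Pi.add_apply] at hI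
  rw [integral_const_mul, integral_add (hVF.const_mul 2) hW,
    integral_add (hVi.const_mul (2 * |x| * ‖g‖ ^ 2)) (hV.2.1.const_mul (2 * ‖g‖ ^ 2)),
    integral_const_mul, integral_const_mul, integral_const_mul, ← hp, ← hv₀, ← hv₁] at hI
  rw [div_mul_eq_mul_div, div_mul_eq_mul_div, le_div_iff₀ hp0]
  refine hI.trans ?_
  have ha := abs_nonneg x
  have hG := sq_nonneg ‖g‖
  set G := ‖g‖ ^ 2
  have e : 2 * (1 + v₀ + v₁) * (G + p) * (1 + |x|) -
      (2 * p + (2 * |x| * G * v₀ + 2 * G * v₁)) =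
      2 * (G * (1 + |x| + v₀ + v₁ * |x|) + p * (|x| + v₀ + v₁ + v₀ * |x| + v₁ * |x|)) := by ring
  have e2 : 0 ≤ 2 * (G * (1 + |x| + v₀ + v₁ * |x|) +
      p * (|x| + v₀ + v₁ + v₀ * |x| + v₁ * |x|)) := by positivity
  linarith

/-- A Hardy inequality, with a remainder controlled by the growth of `F`. -/
theorem LocAC.integral_sq_div_le (hF : LocAC F) (hg : ∀ᵐ x, deriv F x = g x)
    (hF2 : Integrable fun x => F x * F x) {M : ℝ} (hM : ∀ x, F x ^ 2 ≤ M * (1 + |x|)) :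
    ∫ x, F x ^ 2 / (1 + x ^ 2) ≤ 4 * ‖g‖ ^ 2 + 6 * Real.pi * M := by
  have hM0 : 0 ≤ M := by simpa using (sq_nonneg _).trans (hM 0)
  -- A smooth version of Hardy's multiplier `1 / (2x)`. Expanding `∫ (F' - s F)² ≥ 0` and
  -- integrating by parts gives `0 ≤ ‖g‖² + ∫ (s' + s²) F²`.
  set s : ℝ → ℝ := fun x => x / (2 * (1 + x ^ 2)) with hs
  set s' : ℝ → ℝ := fun x => (1 - x ^ 2) / (2 * (1 + x ^ 2) ^ 2) with hs'
  have hpos : ∀ x : ℝ, 0 < 1 + x ^ 2 := fun x => by positivity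
  have hsd : ∀ x, HasDerivAt s (s' x) x := by
    intro x
    have h1 : HasDerivAt (fun x : ℝ => 2 * (1 + x ^ 2)) (2 * (2 * x)) x := by
      simpa using ((hasDerivAt_pow 2 x).const_add 1).const_mul 2
    have h2 := (hasDerivAt_id x).div h1 (by have := hpos x; positivity)
    refine h2.congr_deriv ?_
    simp only [hs', id]
    have := (hpos x).ne'
    field_simp
    ring
  have hsc : ContDiff ℝ 1 s :=
    contDiff_id.div (contDiff_const.mul (contDiff_const.add (contDiff_id.pow 2)))
      fun x => by have := hpos x; positivity
  have hderiv : deriv s = s' := funext fun x => (hsd x).deriv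
  have hs'c : Continuous s' := by
    rw [← hderiv]; exact hsc.continuous_deriv le_rfl
  have hsb : ∀ x, ‖s x‖ ≤ 1 := by
    intro x
    rw [hs, Real.norm_eq_abs, abs_div, abs_of_pos (by have := hpos x; positivity :
      0 < 2 * (1 + x ^ 2)), div_le_one (by have := hpos x; positivity)]
    nlinarith [sq_nonneg (|x| - 1), sq_abs x]
  have hs'b : ∀ x, ‖s' x‖ ≤ 1 := by
    intro x
    rw [hs', Real.norm_eq_abs, abs_div, abs_of_pos (by have := hpos x; positivity :
      0 < 2 * (1 + x ^ 2) ^ 2), div_le_one (by have := hpos x; positivity)]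
    exact abs_le.2 ⟨by nlinarith [sq_nonneg x, sq_nonneg (x ^ 2)],
      by nlinarith [sq_nonneg x, sq_nonneg (x ^ 2)]⟩
  have hgg : Integrable fun x => g x * g x := integrable_mul_L2 g g
  have hFm : MemLp F 2 volume :=
    (memLp_two_iff_integrable_sq hF.continuous.aestronglyMeasurable).2
      (hF2.congr (Eventually.of_forall fun x => (pow_two _).symm))
  have hFg : Integrable fun x => F x * g x := hFm.integrable_mul (Lp.memLp g)
  have hdFF : ∀ᵐ x, deriv (fun y => F y * F y) x = 2 * (F x * g x) := by
    filter_upwards [hF.deriv_mul_ae hF, hg] with x h1 h2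
    rw [h1, h2]; ring
  have i1 : Integrable fun x => s' x * (F x * F x) :=
    hF2.bdd_mul hs'c.aestronglyMeasurable (Eventually.of_forall hs'b)
  have i2 : Integrable fun x => s x * (F x * F x) :=
    hF2.bdd_mul hsc.continuous.aestronglyMeasurable (Eventually.of_forall hsb)
  have i3 : Integrable fun x => s x * (2 * (F x * g x)) :=
    (hFg.const_mul 2).bdd_mul hsc.continuous.aestronglyMeasurable (Eventually.of_forall hsb)
  have i4 : Integrable fun x => s x * (s x * (F x * F x)) :=
    i2.bdd_mul hsc.continuous.aestronglyMeasurable (Eventually.of_forall hsb)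
  have hdFF' : ∀ᵐ x, s x * deriv (fun y => F y * F y) x = s x * (2 * (F x * g x)) :=
    hdFF.mono fun x hx => by rw [hx]
  have hparts : ∫ x, s' x * (F x * F x) = - ∫ x, s x * (2 * (F x * g x)) := by
    rw [← integral_congr_ae hdFF', ← hderiv]
    exact hsc.locAC.integral_deriv_mul_add_eq_zero (hF.mul hF) i2 (by rw [hderiv]; exact i1)
      (i3.congr (hdFF'.mono fun x hx => hx.symm))
  have hnonneg : 0 ≤ ∫ x, ((g x * g x - s x * (2 * (F x * g x))) + s x * (s x * (F x * F x))) := by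
    refine integral_nonneg fun x => ?_
    have : g x * g x - s x * (2 * (F x * g x)) + s x * (s x * (F x * F x)) =
      (g x - s x * F x) ^ 2 := by ring
    simp only [Pi.zero_apply, this]
    positivity
  have i6 : Integrable fun x => g x * g x - s x * (2 * (F x * g x)) := hgg.sub i3
  rw [integral_add i6 i4, integral_sub hgg i3, ← inner_eq_integral,
    real_inner_self_eq_norm_sq] at hnonneg
  have i5 : Integrable fun x => F x ^ 2 / (1 + x ^ 2) := by
    refine (hF2.bdd_mul (f := fun x => (1 + x ^ 2)⁻¹) (c := 1)
      integrable_inv_one_add_sq.aestronglyMeasurable (Eventually.of_forall fun x => ?_)).congr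
      (Eventually.of_forall fun x => ?_)
    · rw [Real.norm_of_nonneg (inv_nonneg.2 (hpos x).le)]
      exact inv_le_one_of_one_le₀ (by nlinarith [sq_nonneg x])
    · simp only; rw [div_eq_mul_inv]; ring
  have hle : ∫ x, (s' x * (F x * F x) + s x * (s x * (F x * F x))) ≤
      ∫ x, (3 / 2 * M * (1 + x ^ 2)⁻¹ - 1 / 4 * (F x ^ 2 / (1 + x ^ 2))) := by
    refine integral_mono (i1.add i4)
      ((integrable_inv_one_add_sq.const_mul _).sub (i5.const_mul _)) fun x => ?_
    -- `s' + s² = (3/4) (1 + x²)⁻² - (1/4) (1 + x²)⁻¹`. The negative term is the Hardy density; the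
    -- growth bound makes the other integrable with a bound in `M`.
    have h1 : s' x * (F x * F x) + s x * (s x * (F x * F x)) =
        3 / 4 * (F x ^ 2 / (1 + x ^ 2) ^ 2) - 1 / 4 * (F x ^ 2 / (1 + x ^ 2)) := by
      simp only [hs, hs']
      have := (hpos x).ne'
      field_simp
      ring
    have h2 : F x ^ 2 / (1 + x ^ 2) ^ 2 ≤ 2 * M * (1 + x ^ 2)⁻¹ := by
      rw [div_le_iff₀ (by have := hpos x; positivity)]
      have h3 : 2 * M * (1 + x ^ 2)⁻¹ * (1 + x ^ 2) ^ 2 = M * (2 * (1 + x ^ 2)) := by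
        have := (hpos x).ne'
        field_simp
      rw [h3]
      refine (hM x).trans (mul_le_mul_of_nonneg_left ?_ hM0)
      nlinarith [sq_nonneg (|x| - 1), sq_abs x]
    simp only [h1]
    linarith
  rw [integral_add i1 i4, integral_sub (integrable_inv_one_add_sq.const_mul _) (i5.const_mul _),
    integral_const_mul, integral_const_mul, integral_univ_inv_one_add_sq, hparts] at hle
  linarith

theorem pow_five_le_of_forall_le {N m D : ℝ} (hN : 0 ≤ N) (hm : 0 ≤ m) (hD : 0 ≤ D)
    (h : ∀ l > 0, l ^ 4 * N ≤ l ^ 5 * m + D) : N ^ 5 ≤ 32 * m ^ 4 * D := by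
  rcases hN.eq_or_lt with rfl | hN
  · rw [zero_pow (by norm_num)]; positivity
  rcases hm.eq_or_lt with rfl | hm
  · exfalso
    -- If `m = 0`, this `l` gives `l⁴ N ≥ l N = N + D > D`, a contradiction.
    have h1 := h (1 + D / N) (by positivity)
    have h2 : 1 + D / N ≤ (1 + D / N) ^ 4 :=
      le_self_pow₀ (by linarith [div_nonneg hD hN.le]) (by norm_num)
    have h3 : (1 + D / N) * N = N + D := by field_simp
    nlinarith [mul_le_mul_of_nonneg_right h2 hN.le]
  -- With this `l`, the term `l⁵ m` is half of `l⁴ N` and is absorbed on the left.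
  · have h1 := h (N / (2 * m)) (by positivity)
    have h2 : (N / (2 * m)) ^ 4 * N = N ^ 5 / (16 * m ^ 4) := by field_simp; ring
    have h3 : (N / (2 * m)) ^ 5 * m = N ^ 5 / (32 * m ^ 4) := by field_simp; ring
    rw [h2, h3] at h1
    have h4 : N ^ 5 / (16 * m ^ 4) = 2 * (N ^ 5 / (32 * m ^ 4)) := by field_simp; ring
    rw [h4] at h1
    have h5 : N ^ 5 / (32 * m ^ 4) ≤ D := by linarith
    rw [div_le_iff₀ (by positivity)] at h5
    linarith

/-- Pointwise interpolation between the weighted `L¹` density and the Hardy density. -/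
theorem pow_four_mul_sq_le {y x M l : ℝ} (hl : 0 < l) (hy : y ^ 2 ≤ M * (1 + |x|)) :
    l ^ 4 * y ^ 2 ≤ l ^ 5 * ((1 + |x|) * |y|) + M ^ 2 * (y ^ 2 / (1 + x ^ 2)) := by
  have hw : 0 < 1 + |x| := by positivity
  have hx : 1 + x ^ 2 ≤ (1 + |x|) ^ 2 := by nlinarith [sq_abs x, abs_nonneg x]
  have hp : 0 < 1 + x ^ 2 := by positivity
  rcases le_total |y| (l * (1 + |x|)) with h | h
  · have h1 : y ^ 2 ≤ l * (1 + |x|) * |y| := by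
      rw [← sq_abs, pow_two]
      exact mul_le_mul_of_nonneg_right h (abs_nonneg y)
    have h2 : l ^ 4 * y ^ 2 ≤ l ^ 4 * (l * (1 + |x|) * |y|) :=
      mul_le_mul_of_nonneg_left h1 (by positivity)
    have h3 : 0 ≤ M ^ 2 * (y ^ 2 / (1 + x ^ 2)) := by positivity
    linarith
  -- Where `|y|` is large, the growth bound confines `x` to `l² (1 + |x|) ≤ M`, and there the Hardy
  -- density dominates.
  · have h1 : (l * (1 + |x|)) ^ 2 ≤ M * (1 + |x|) :=
      (pow_le_pow_left₀ (by positivity) h 2).trans (by rw [sq_abs]; exact hy)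
    have h2 : l ^ 2 * (1 + |x|) ≤ M := by
      refine le_of_mul_le_mul_right ?_ hw
      linarith
    have h3 : l ^ 4 * (1 + |x|) ^ 2 ≤ M ^ 2 := by
      have := pow_le_pow_left₀ (by positivity) h2 2
      linarith
    have h4 : l ^ 4 * (1 + x ^ 2) ≤ M ^ 2 :=
      (mul_le_mul_of_nonneg_left hx (by positivity)).trans h3
    have h5 : l ^ 4 * y ^ 2 ≤ M ^ 2 * (y ^ 2 / (1 + x ^ 2)) := by
      rw [mul_div_assoc', le_div_iff₀ hp]
      nlinarith [mul_le_mul_of_nonneg_right h4 (sq_nonneg y)]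
    have h6 : 0 ≤ l ^ 5 * ((1 + |x|) * |y|) := by positivity
    linarith

/-- The three-dimensional Nash inequality for the form `‖f'‖² + ⟪V f, f⟫` with weight
`1 + |x|`. -/
theorem exists_nash {V : ℝ →ᵇ ℝ} (hV : V ∈ potentialClass) :
    ∃ C > 0, ∀ f g : L2, IsWeakDeriv f g → (Integrable fun x => (1 + |x|) * |f x|) →
      (‖f‖ ^ 2) ^ 5 ≤ C * (∫ x, (1 + |x|) * |f x|) ^ 4 *
        (‖g‖ ^ 2 + inner ℝ (mulOp V f) f) ^ 3 := by
  obtain ⟨K, hK, hbound⟩ := exists_sq_le_mul_form hV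
  refine ⟨32 * (K ^ 2 * (4 + 6 * Real.pi * K)), by positivity, fun f g hfg hfi => ?_⟩
  obtain ⟨F, hF, hFf, hFg⟩ := hfg.exists_locAC
  have hF2 : Integrable fun x => F x * F x := by
    refine (integrable_mul_L2 f f).congr (hFf.mono fun x hx => ?_)
    simp only [hx]
  have hq : inner ℝ (mulOp V f) f = ∫ x, V x * (F x * F x) := by
    rw [inner_mulOp]
    exact integral_congr_ae (hFf.mono fun x hx => by simp only [hx])
  have hN : ‖f‖ ^ 2 = ∫ x, F x ^ 2 := by
    rw [← real_inner_self_eq_norm_sq, inner_eq_integral]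
    exact integral_congr_ae (hFf.mono fun x hx => by simp only [hx]; ring)
  have hmF : (fun x => (1 + |x|) * |f x|) =ᵐ[volume] fun x => (1 + |x|) * |F x| :=
    hFf.mono fun x hx => by simp only [hx]
  have hqn : 0 ≤ inner ℝ (mulOp V f) f := inner_mulOp_nonneg hV.1 f
  have hpt := hbound F g hF hFg hF2
  rw [← hq] at hpt
  set q := ‖g‖ ^ 2 + inner ℝ (mulOp V f) f with hqdef
  have hq0 : 0 ≤ q := by positivity
  have hgq : ‖g‖ ^ 2 ≤ q := by linarith
  have hH := hF.integral_sq_div_le hFg hF2 hpt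
  set m := ∫ x, (1 + |x|) * |f x| with hm
  have hH' : ∫ x, F x ^ 2 / (1 + x ^ 2) ≤ (4 + 6 * Real.pi * K) * q := by
    refine hH.trans ?_
    linarith
  have iF : Integrable fun x => F x ^ 2 := hF2.congr (Eventually.of_forall fun x => (pow_two _).symm)
  have iH : Integrable fun x => F x ^ 2 / (1 + x ^ 2) := by
    refine iF.mono' (hF.continuous.pow 2 |>.div (by fun_prop)
      fun x => by positivity).aestronglyMeasurable (Eventually.of_forall fun x => ?_)
    rw [Real.norm_of_nonneg (by positivity)]
    exact div_le_self (sq_nonneg _) (by nlinarith [sq_nonneg x])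
  have iw : Integrable fun x => (1 + |x|) * |F x| := hfi.congr hmF
  have key : ∀ l > 0, l ^ 4 * ‖f‖ ^ 2 ≤ l ^ 5 * m + (K * q) ^ 2 * ((4 + 6 * Real.pi * K) * q) := by
    intro l hl
    have h1 := integral_mono (iF.const_mul (l ^ 4)) ((iw.const_mul (l ^ 5)).add
      (iH.const_mul ((K * q) ^ 2))) fun x => pow_four_mul_sq_le hl (hpt x)
    simp only [Pi.add_apply] at h1
    rw [integral_add (iw.const_mul (l ^ 5)) (iH.const_mul ((K * q) ^ 2)), integral_const_mul,
      integral_const_mul, integral_const_mul, ← hN, ← integral_congr_ae hmF] at h1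
    refine h1.trans (add_le_add_right (mul_le_mul_of_nonneg_left hH' (by positivity)) _)
  have hm0 : 0 ≤ m := integral_nonneg fun x => by positivity
  refine (pow_five_le_of_forall_le (sq_nonneg _) hm0 (by positivity) key).trans_eq ?_
  ring

end Nash
end SchrodingerNash

/-! ### Conclusion for the weight `ψ₁ + ψ₂` -/

theorem proposition3p4 (V : ℝ →ᵇ ℝ) (hV : V ∈ potentialClass) (ψ₁ ψ₂ : ℝ → ℝ)
    (hψ : IsHarmonicPair V ψ₁ ψ₂) :
    (nonnegSqrt (schrodinger V)).domain = H1 ∧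
    ∃ C : ℝ, 0 < C ∧
      ∀ f : (nonnegSqrt (schrodinger V)).domain,
        Integrable (fun x => (ψ₁ x + ψ₂ x) * (f : L2) x) →
        ‖(f : L2)‖ ^ (2 + 4 / 3 : ℝ) ≤
          C * (∫ x, |(ψ₁ x + ψ₂ x) * (f : L2) x|) ^ (4 / 3 : ℝ) *
            ‖nonnegSqrt (schrodinger V) f‖ ^ 2 := by
  refine ⟨domain_nonnegSqrt_schrodinger hV.1, ?_⟩
  obtain ⟨C, hC, hnash⟩ := exists_nash hV
  obtain ⟨L, hL, hw⟩ := hψ.exists_weight_le hV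
  refine ⟨(C * L ^ 4) ^ (1 / 3 : ℝ), by positivity, fun f hf => ?_⟩
  obtain ⟨g, hg, hnorm⟩ := norm_sq_nonnegSqrt_schrodinger hV.1 f
  have hle : ∀ x, (1 + |x|) * |(f : L2) x| ≤ L * |(ψ₁ x + ψ₂ x) * (f : L2) x| := by
    intro x
    rw [abs_mul, ← mul_assoc]
    refine mul_le_mul_of_nonneg_right ((hw x).trans ?_) (abs_nonneg _)
    exact mul_le_mul_of_nonneg_left (le_abs_self _) hL.le
  have hi : Integrable fun x => (1 + |x|) * |(f : L2) x| := by
    refine (hf.abs.const_mul L).mono' ?_ (Eventually.of_forall fun x => ?_)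
    · exact (by fun_prop : Continuous fun x : ℝ => 1 + |x|).aestronglyMeasurable.mul
        (Lp.aestronglyMeasurable (f : L2)).norm
    · rw [Real.norm_of_nonneg (by positivity)]
      exact hle x
  have hm : ∫ x, (1 + |x|) * |(f : L2) x| ≤ L * ∫ x, |(ψ₁ x + ψ₂ x) * (f : L2) x| := by
    rw [← integral_const_mul]
    exact integral_mono hi (hf.abs.const_mul L) hle
  set I := ∫ x, |(ψ₁ x + ψ₂ x) * (f : L2) x| with hI
  have hI0 : 0 ≤ I := integral_nonneg fun x => abs_nonneg _
  have h1 := hnash f g hg hi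
  rw [← hnorm] at h1
  set q := ‖nonnegSqrt (schrodinger V) f‖ ^ 2 with hq
  have hq0 : 0 ≤ q := sq_nonneg _
  have h2 : ‖(f : L2)‖ ^ (10 : ℕ) ≤ (C * L ^ 4) * (I ^ 4 * q ^ 3) := by
    have h3 : (∫ x, (1 + |x|) * |(f : L2) x|) ^ 4 ≤ (L * I) ^ 4 :=
      pow_le_pow_left₀ (integral_nonneg fun x => by positivity) hm 4
    calc ‖(f : L2)‖ ^ (10 : ℕ) = (‖(f : L2)‖ ^ 2) ^ 5 := by ring
      _ ≤ C * (∫ x, (1 + |x|) * |(f : L2) x|) ^ 4 * q ^ 3 := h1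
      _ ≤ C * (L * I) ^ 4 * q ^ 3 := by gcongr
      _ = (C * L ^ 4) * (I ^ 4 * q ^ 3) := by ring
  have hD : 0 < C * L ^ 4 := by positivity
  generalize C * L ^ 4 = D at h2 hD ⊢
  -- Taking cube roots turns the powers 10, 4 and 3 into `10/3 = 2 + 4/3`, `4/3` and 1.
  have h4 := Real.rpow_le_rpow (by positivity) h2 (by norm_num : (0 : ℝ) ≤ 1 / 3)
  rw [Real.mul_rpow (by positivity) (by positivity), Real.mul_rpow (by positivity) (by positivity),
    ← Real.rpow_natCast, ← Real.rpow_natCast, ← Real.rpow_natCast, ← Real.rpow_mul (norm_nonneg _),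
    ← Real.rpow_mul hI0, ← Real.rpow_mul hq0] at h4
  norm_num at h4 ⊢
  rw [mul_assoc]
  exact h4
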